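/- **Definitions.** A *curve* is a differentiable function $f:[a,b]\to\mathbb C$ ($a<b$) whose derivative $f'$ is absolutely continuous and nowhere zero. Its length is $L=\int_a^b|f'(t)|\,dt$, and the unit speed curve described by $f$ is $[f]=F:[0,L]\to\mathbb C$, $F(s)=f(t)$ where $s=\int_a^t|f'(r)|\,dr$. Two curves $f,g$ are *equivalent* if $[f]=[g]$. There is an absolutely continuous $\tau:[0,L]\to\mathbb R$, unique up to an additive constant in $2\pi\mathbb Z$, with $F'=e^{i\tau}$; the *signed curvature* is $\kappa=\tau'$ (defined almost everywhere), the *turning angle* is $\int_0^L\kappa\,ds$, and the *bending energy* of $f$ is $\|f\|^2=\frac14\int_0^L\kappa(s)^2\,ds\in[0,\infty]$. The curve $f$ is a *left-curve* (resp. *right-curve*) if $\kappa\ge0$ (resp. $\kappa\le 0$) almost everywhere, and a *c-curve* is a left-curve or a right-curve whose turning angle has magnitude at most $\pi$. An *s-curve* is a curve that is either a c-curve or, up to equivalence, the concatenation $f_1\sqcup f_2$ of two c-curves, one a left-curve and the other a right-curve (in either order), where the terminal unit tangent vector of $f_1$ equals the initial unit tangent vector of $f_2$. The *unit tangent vector*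 of $f$ at $t$ is the pair $(f(t),f'(t)/|f'(t)|)$; $f$ *connects* $u$ to $v$ if its unit tangent vectors at $a$ and $b$ are $u$ and $v$, and $S(u,v)$ denotes the set of all s-curves connecting $u$ to $v$. Let $E(t)=\sin t+i\,\xi(t)$, $t\in\mathbb R$, where $\xi(t)=\int_0^t\frac{\sin^2 r}{\sqrt{1+\sin^2 r}}\,dr$; let $TE(t)=(E(t),E'(t)/|E'(t)|)$, and let $E_{[t_1,t_2]}$ be the restriction of $E$ to $[t_1,t_2]$. **Theorem 6.1.** Let $0\le t_1<t_2\le\pi$ with $t_2-t_1<\pi$. Then $E_{[t_1,t_2]}$ belongs to $S(TE(t_1),TE(t_2))$ and has minimal bending energy in $S(TE(t_1),TE(t_2))$, and every curve in $S(TE(t_1),TE(t_2))$ of minimal bending energy is equivalent to $E_{[t_1,t_2]}$. -/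

import Mathlib

open Set MeasureTheory Filter Topology
open scoped ENNReal NNReal

/-! ### Plane curves -/

/-- A curve: a differentiable function `[a, b] → ℂ` (`a < b`) whose derivative is absolutely
continuous and nowhere zero. Differentiability is on the closed interval (one-sided at the
endpoints); the values of `toFun` outside `[a, b]` are irrelevant. -/
structure PlaneCurve where
  /-- left endpoint of the parameter interval -/
  a : ℝ
  /-- right endpoint of the parameter interval -/
  b : ℝ
  lt : a < b
  /-- the map itself -/
  toFun : ℝ → ℂ
  differentiableOn : DifferentiableOn ℝ toFun (Icc a b)
  absCont : AbsolutelyContinuousOnInterval (derivWithin toFun (Icc a b)) a b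
  ne_zero : ∀ t ∈ Icc a b, derivWithin toFun (Icc a b) t ≠ 0

/-- A unit tangent vector: a base point together with a direction of modulus one. -/
@[ext]
structure UnitTangentVector where
  /-- the base point -/
  pos : ℂ
  /-- the direction -/
  dir : ℂ
  norm_dir : ‖dir‖ = 1

theorem absCont_of_locally_dist_le {X Y : Type*} [PseudoMetricSpace X] [PseudoMetricSpace Y]
    {g : ℝ → X} {h : ℝ → Y} {a b δ₀ K : ℝ} (hδ₀ : 0 < δ₀) (hK : 0 ≤ K)
    (hg : AbsolutelyContinuousOnInterval g a b)
    (hgh : ∀ x ∈ uIcc a b, ∀ y ∈ uIcc a b, dist x y < δ₀ → dist (h x) (h y) ≤ K * dist (g x) (g y)) :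
    AbsolutelyContinuousOnInterval h a b := by
  rw [absolutelyContinuousOnInterval_iff] at hg ⊢
  intro ε hε
  obtain ⟨δ, hδ, H⟩ := hg (ε / (K + 1)) (by positivity)
  refine ⟨min δ δ₀, lt_min hδ hδ₀, fun E hE hlt => ?_⟩
  have h1 := H E hE (hlt.trans_le (min_le_left _ _))
  calc ∑ i ∈ Finset.range E.1, dist (h (E.2 i).1) (h (E.2 i).2)
      ≤ ∑ i ∈ Finset.range E.1, K * dist (g (E.2 i).1) (g (E.2 i).2) := by
        refine Finset.sum_le_sum fun i hi => hgh _ (hE.1 i hi).1 _ (hE.1 i hi).2 ?_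
        refine lt_of_le_of_lt ?_ (hlt.trans_le (min_le_right _ _))
        exact Finset.single_le_sum (f := fun i => dist (E.2 i).1 (E.2 i).2)
          (fun _ _ => dist_nonneg) hi
    _ = K * ∑ i ∈ Finset.range E.1, dist (g (E.2 i).1) (g (E.2 i).2) := by rw [Finset.mul_sum]
    _ ≤ K * (ε / (K + 1)) := by gcongr
    _ < (K + 1) * (ε / (K + 1)) := by gcongr; linarith
    _ = ε := by field_simp

theorem absCont_comp_of_monotoneOn {X : Type*} [PseudoMetricSpace X] {g : ℝ → X} {φ : ℝ → ℝ}
    {a b c d : ℝ} {K : ℝ≥0} (hab : a ≤ b) (hcd : c ≤ d)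
    (hg : AbsolutelyContinuousOnInterval g a b) (hmono : MonotoneOn φ (Icc c d))
    (hmaps : MapsTo φ (Icc c d) (Icc a b)) (hlip : LipschitzOnWith K φ (Icc c d)) :
    AbsolutelyContinuousOnInterval (fun s => g (φ s)) c d := by
  rw [absolutelyContinuousOnInterval_iff] at hg ⊢
  intro ε hε
  obtain ⟨δ, hδ, H⟩ := hg ε hε
  refine ⟨δ / (K + 1), by positivity, fun E hE hlt => ?_⟩
  obtain ⟨hE1, hE2⟩ := hE
  rw [uIcc_of_le hcd] at hE1
  have hmin : ∀ x ∈ Icc c d, ∀ y ∈ Icc c d, φ (min x y) = min (φ x) (φ y) := by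
    intro x hx y hy
    rcases le_total x y with h | h
    · rw [min_eq_left h, min_eq_left (hmono hx hy h)]
    · rw [min_eq_right h, min_eq_right (hmono hy hx h)]
  have hmax : ∀ x ∈ Icc c d, ∀ y ∈ Icc c d, φ (max x y) = max (φ x) (φ y) := by
    intro x hx y hy
    rcases le_total x y with h | h
    · rw [max_eq_right h, max_eq_right (hmono hx hy h)]
    · rw [max_eq_left h, max_eq_left (hmono hy hx h)]
  have hcmin : ∀ x ∈ Icc c d, ∀ y ∈ Icc c d, min x y ∈ Icc c d := by
    intro x hx y hy
    exact ⟨le_min hx.1 hy.1, (min_le_left _ _).trans hx.2⟩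
  have hcmax : ∀ x ∈ Icc c d, ∀ y ∈ Icc c d, max x y ∈ Icc c d := by
    intro x hx y hy
    exact ⟨hx.1.trans (le_max_left _ _), max_le hx.2 hy.2⟩
  refine H (E.1, fun i => (φ (E.2 i).1, φ (E.2 i).2)) ⟨?_, ?_⟩ ?_
  · intro i hi
    rw [uIcc_of_le hab]
    exact ⟨hmaps (hE1 i hi).1, hmaps (hE1 i hi).2⟩
  · intro i hi j hj hij
    have h1 := hE2 hi hj hij
    obtain ⟨hi1, hi2⟩ := hE1 i (by simpa using hi)
    obtain ⟨hj1, hj2⟩ := hE1 j (by simpa using hj)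
    simp only [Function.onFun, uIoc, Ioc_disjoint_Ioc] at h1 ⊢
    rw [← hmin _ hi1 _ hi2, ← hmin _ hj1 _ hj2, ← hmax _ hi1 _ hi2, ← hmax _ hj1 _ hj2,
      ← hmin _ (hcmax _ hi1 _ hi2) _ (hcmax _ hj1 _ hj2),
      ← hmax _ (hcmin _ hi1 _ hi2) _ (hcmin _ hj1 _ hj2)]
    exact hmono (hcmin _ (hcmax _ hi1 _ hi2) _ (hcmax _ hj1 _ hj2))
      (hcmax _ (hcmin _ hi1 _ hi2) _ (hcmin _ hj1 _ hj2)) h1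
  · calc ∑ i ∈ Finset.range E.1, dist (φ (E.2 i).1) (φ (E.2 i).2)
        ≤ ∑ i ∈ Finset.range E.1, K * dist (E.2 i).1 (E.2 i).2 :=
          Finset.sum_le_sum fun i hi => hlip.dist_le_mul _ (hE1 i hi).1 _ (hE1 i hi).2
      _ = K * ∑ i ∈ Finset.range E.1, dist (E.2 i).1 (E.2 i).2 := by rw [Finset.mul_sum]
      _ ≤ K * (δ / (K + 1)) := by gcongr
      _ < (K + 1) * (δ / (K + 1)) := by gcongr; linarith
      _ = δ := by field_simp

theorem dist_normalize_le {z w : ℂ} {m : ℝ} (hm : 0 < m) (hz : m ≤ ‖z‖) (hw : w ≠ 0) :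
    dist (z / (‖z‖ : ℂ)) (w / (‖w‖ : ℂ)) ≤ 2 / m * dist z w := by
  have hz0 : 0 < ‖z‖ := hm.trans_le hz
  have hw0 : 0 < ‖w‖ := norm_pos_iff.mpr hw
  have e : z / (‖z‖ : ℂ) - w / (‖w‖ : ℂ)
      = (z - w) / (‖z‖ : ℂ) + (w / (‖w‖ : ℂ)) * (((‖w‖ - ‖z‖ : ℝ) : ℂ) / (‖z‖ : ℂ)) := by
    have h1 : (‖z‖ : ℂ) ≠ 0 := by exact_mod_cast hz0.ne'
    have h2 : (‖w‖ : ℂ) ≠ 0 := by exact_mod_cast hw0.ne'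
    push_cast
    field_simp
    ring
  rw [dist_eq_norm, dist_eq_norm, e]
  refine (norm_add_le _ _).trans ?_
  rw [norm_mul, norm_div, norm_div, norm_div, Complex.norm_real, Complex.norm_real,
    Complex.norm_real, norm_norm, norm_norm, div_self hw0.ne', one_mul]
  have h3 : ‖(‖w‖ - ‖z‖ : ℝ)‖ ≤ ‖z - w‖ := by
    rw [norm_sub_rev z w]; exact abs_norm_sub_norm_le w z
  calc ‖z - w‖ / ‖z‖ + ‖(‖w‖ - ‖z‖ : ℝ)‖ / ‖z‖ ≤ ‖z - w‖ / m + ‖z - w‖ / m := by gcongr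
    _ = 2 / m * ‖z - w‖ := by ring

namespace PlaneCurve

/-- The derivative `f'` on `[a, b]`. -/
noncomputable def vel (f : PlaneCurve) (t : ℝ) : ℂ := derivWithin f.toFun (Icc f.a f.b) t

/-- The unit tangent vector `(f(t), f'(t)/|f'(t)|)` to `f` at `t ∈ [a, b]`. -/
noncomputable def tangent (f : PlaneCurve) (t : ℝ) (ht : t ∈ Icc f.a f.b) : UnitTangentVector where
  pos := f.toFun t
  dir := f.vel t / (‖f.vel t‖ : ℂ)
  norm_dir := by
    have h : ‖f.vel t‖ ≠ 0 := norm_ne_zero_iff.mpr (f.ne_zero t ht)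
    rw [norm_div, Complex.norm_real, norm_norm, div_self h]

/-- The initial unit tangent vector. -/
noncomputable def initial (f : PlaneCurve) : UnitTangentVector :=
  f.tangent f.a (left_mem_Icc.mpr f.lt.le)

/-- The terminal unit tangent vector. -/
noncomputable def terminal (f : PlaneCurve) : UnitTangentVector :=
  f.tangent f.b (right_mem_Icc.mpr f.lt.le)

/-- `f` connects `u` to `v`. -/
def Connects (f : PlaneCurve) (u v : UnitTangentVector) : Prop :=
  f.initial = u ∧ f.terminal = v

/-- Arc length from the initial point, `s(t) = ∫_a^t |f'|`. -/
noncomputable def arcLength (f : PlaneCurve) (t : ℝ) : ℝ := ∫ r in f.a..t, ‖f.vel r‖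

/-- The length of the curve. -/
noncomputable def length (f : PlaneCurve) : ℝ := f.arcLength f.b

/-- The inverse `[0, L] → [a, b]` of the arc length function. -/
noncomputable def arcParam (f : PlaneCurve) (s : ℝ) : ℝ :=
  Function.invFunOn f.arcLength (Icc f.a f.b) s

theorem continuousOn_vel (f : PlaneCurve) : ContinuousOn f.vel (Icc f.a f.b) := by
  have h := f.absCont.continuousOn
  rwa [uIcc_of_le f.lt.le] at h

theorem exists_speed_lower_bound (f : PlaneCurve) :
    ∃ m : ℝ, 0 < m ∧ ∀ t ∈ Icc f.a f.b, m ≤ ‖f.vel t‖ := by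
  obtain ⟨x, hx, hmin⟩ := isCompact_Icc.exists_isMinOn (nonempty_Icc.mpr f.lt.le)
    f.continuousOn_vel.norm
  exact ⟨‖f.vel x‖, norm_pos_iff.mpr (f.ne_zero x hx), fun t ht => hmin ht⟩

theorem intervalIntegrable_speed (f : PlaneCurve) {x y : ℝ} (hx : x ∈ Icc f.a f.b)
    (hy : y ∈ Icc f.a f.b) : IntervalIntegrable (fun r => ‖f.vel r‖) volume x y := by
  refine ContinuousOn.intervalIntegrable (f.continuousOn_vel.norm.mono ?_)
  exact uIcc_subset_Icc hx hy

theorem mul_sub_le_arcLength_sub (f : PlaneCurve) {m : ℝ}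
    (hm : ∀ t ∈ Icc f.a f.b, m ≤ ‖f.vel t‖) {x y : ℝ} (hx : x ∈ Icc f.a f.b)
    (hy : y ∈ Icc f.a f.b) (hxy : x ≤ y) : m * (y - x) ≤ f.arcLength y - f.arcLength x := by
  have ha : f.a ∈ Icc f.a f.b := left_mem_Icc.mpr f.lt.le
  unfold arcLength
  rw [intervalIntegral.integral_interval_sub_left (f.intervalIntegrable_speed ha hy)
    (f.intervalIntegrable_speed ha hx)]
  have h := intervalIntegral.integral_mono_on hxy intervalIntegrable_const
    (f.intervalIntegrable_speed hx hy)
    (fun t ht => hm t ⟨hx.1.trans ht.1, ht.2.trans hy.2⟩)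
  rw [intervalIntegral.integral_const, smul_eq_mul] at h
  linarith

theorem hasDerivWithinAt_arcLength (f : PlaneCurve) {t : ℝ} (ht : t ∈ Icc f.a f.b) :
    HasDerivWithinAt f.arcLength ‖f.vel t‖ (Icc f.a f.b) t := by
  have ha : f.a ∈ Icc f.a f.b := left_mem_Icc.mpr f.lt.le
  have : Fact (t ∈ Icc f.a f.b) := ⟨ht⟩
  refine intervalIntegral.integral_hasDerivWithinAt_right (f.intervalIntegrable_speed ha ht)
    (t := Icc f.a f.b) ?_ (f.continuousOn_vel.norm t ht)
  exact ContinuousOn.stronglyMeasurableAtFilter_nhdsWithin f.continuousOn_vel.norm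
    measurableSet_Icc t

theorem arcLength_left (f : PlaneCurve) : f.arcLength f.a = 0 := by
  simp [arcLength]

theorem strictMonoOn_arcLength (f : PlaneCurve) : StrictMonoOn f.arcLength (Icc f.a f.b) := by
  obtain ⟨m, hm0, hm⟩ := f.exists_speed_lower_bound
  intro x hx y hy hxy
  have h := f.mul_sub_le_arcLength_sub hm hx hy hxy.le
  have : 0 < m * (y - x) := mul_pos hm0 (sub_pos.mpr hxy)
  linarith

theorem length_pos (f : PlaneCurve) : 0 < f.length := by
  have h := f.strictMonoOn_arcLength (left_mem_Icc.mpr f.lt.le) (right_mem_Icc.mpr f.lt.le) f.lt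
  rwa [f.arcLength_left] at h

theorem image_arcLength (f : PlaneCurve) : Icc 0 f.length ⊆ f.arcLength '' Icc f.a f.b := by
  have hc : ContinuousOn f.arcLength (Icc f.a f.b) :=
    fun t ht => (f.hasDerivWithinAt_arcLength ht).continuousWithinAt
  have h := intermediate_value_Icc f.lt.le hc
  rwa [f.arcLength_left] at h

theorem arcParam_mem (f : PlaneCurve) {s : ℝ} (hs : s ∈ Icc 0 f.length) :
    f.arcParam s ∈ Icc f.a f.b := Function.invFunOn_mem (f.image_arcLength hs)

theorem arcLength_arcParam (f : PlaneCurve) {s : ℝ} (hs : s ∈ Icc 0 f.length) :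
    f.arcLength (f.arcParam s) = s := Function.invFunOn_eq (f.image_arcLength hs)

theorem monotoneOn_arcParam (f : PlaneCurve) : MonotoneOn f.arcParam (Icc 0 f.length) := by
  intro x hx y hy hxy
  by_contra hlt
  have h := f.strictMonoOn_arcLength (f.arcParam_mem hy) (f.arcParam_mem hx) (not_le.mp hlt)
  rw [f.arcLength_arcParam hx, f.arcLength_arcParam hy] at h
  linarith

theorem exists_lipschitz_arcParam (f : PlaneCurve) :
    ∃ K : ℝ≥0, LipschitzOnWith K f.arcParam (Icc 0 f.length) := by
  obtain ⟨m, hm0, hm⟩ := f.exists_speed_lower_bound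
  refine ⟨⟨m⁻¹, by positivity⟩, LipschitzOnWith.of_dist_le_mul ?_⟩
  have key : ∀ x ∈ Icc 0 f.length, ∀ y ∈ Icc 0 f.length, x ≤ y →
      dist (f.arcParam x) (f.arcParam y) ≤ m⁻¹ * dist x y := by
    intro x hx y hy hxy
    have h1 := f.monotoneOn_arcParam hx hy hxy
    have h := f.mul_sub_le_arcLength_sub hm (f.arcParam_mem hx) (f.arcParam_mem hy) h1
    rw [f.arcLength_arcParam hx, f.arcLength_arcParam hy] at h
    rw [dist_comm, dist_comm x y, Real.dist_eq, Real.dist_eq, abs_of_nonneg (sub_nonneg.mpr h1),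
      abs_of_nonneg (sub_nonneg.mpr hxy), inv_mul_eq_div, le_div_iff₀ hm0]
    linarith
  intro x hx y hy
  rcases le_total x y with hxy | hxy
  · exact key x hx y hy hxy
  · rw [dist_comm, dist_comm x y]
    exact key y hy x hx hxy

theorem hasDerivWithinAt_unitSpeed (f : PlaneCurve) {s : ℝ} (hs : s ∈ Icc 0 f.length) :
    HasDerivWithinAt (fun s => f.toFun (f.arcParam s))
      (f.vel (f.arcParam s) / (‖f.vel (f.arcParam s)‖ : ℂ)) (Icc 0 f.length) s := by
  obtain ⟨K, hK⟩ := f.exists_lipschitz_arcParam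
  have hp := f.arcParam_mem hs
  have hmaps : MapsTo f.arcParam (Icc 0 f.length) (Icc f.a f.b) := fun x hx => f.arcParam_mem hx
  have hne : ‖f.vel (f.arcParam s)‖ ≠ 0 := norm_ne_zero_iff.mpr (f.ne_zero _ hp)
  have hσ := f.hasDerivWithinAt_arcLength hp
  have hφ : HasDerivWithinAt f.arcParam (‖f.vel (f.arcParam s)‖⁻¹) (Icc 0 f.length) s := by
    have h1 : Tendsto f.arcParam (𝓝[Icc 0 f.length] s) (𝓝[Icc f.a f.b] (f.arcParam s)) :=
      (hK.continuousOn s hs).tendsto_nhdsWithin hmaps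
    have h2 : HasFDerivWithinAt f.arcLength
        (ContinuousLinearEquiv.unitsEquivAut ℝ (Units.mk0 _ hne) : ℝ →L[ℝ] ℝ)
        (Icc f.a f.b) (f.arcParam s) := by
      have h3 : ((ContinuousLinearEquiv.unitsEquivAut ℝ (Units.mk0 _ hne) : ℝ ≃L[ℝ] ℝ) : ℝ →L[ℝ] ℝ)
          = ContinuousLinearMap.toSpanSingleton ℝ ‖f.vel (f.arcParam s)‖ := by
        ext; simp
      rw [h3]
      exact hσ.hasFDerivWithinAt
    have h3 := HasFDerivWithinAt.of_local_left_inverse h1 h2 hs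
      (eventually_nhdsWithin_of_forall fun x hx => f.arcLength_arcParam hx)
    have h4 := h3.hasDerivWithinAt
    simpa using h4
  have hf : HasDerivWithinAt f.toFun (f.vel (f.arcParam s)) (Icc f.a f.b) (f.arcParam s) :=
    (f.differentiableOn _ hp).hasDerivWithinAt
  have h := hf.scomp s hφ hmaps
  rw [Complex.real_smul, Complex.ofReal_inv, inv_mul_eq_div] at h
  exact h

theorem derivWithin_unitSpeed (f : PlaneCurve) {s : ℝ} (hs : s ∈ Icc 0 f.length) :
    derivWithin (fun s => f.toFun (f.arcParam s)) (Icc 0 f.length) s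
      = f.vel (f.arcParam s) / (‖f.vel (f.arcParam s)‖ : ℂ) :=
  (f.hasDerivWithinAt_unitSpeed hs).derivWithin (uniqueDiffOn_Icc f.length_pos s hs)

theorem norm_derivWithin_unitSpeed (f : PlaneCurve) {s : ℝ} (hs : s ∈ Icc 0 f.length) :
    ‖derivWithin (fun s => f.toFun (f.arcParam s)) (Icc 0 f.length) s‖ = 1 := by
  have h : ‖f.vel (f.arcParam s)‖ ≠ 0 := norm_ne_zero_iff.mpr (f.ne_zero _ (f.arcParam_mem hs))
  rw [f.derivWithin_unitSpeed hs, norm_div, Complex.norm_real, norm_norm, div_self h]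

/-- The unit speed curve `[f] = F : [0, L] → ℂ` described by `f`, i.e. `F(s) = f(t)` where
`s = ∫_a^t |f'|`. -/
noncomputable def unitSpeed (f : PlaneCurve) : PlaneCurve where
  a := 0
  b := f.length
  lt := f.length_pos
  toFun := fun s => f.toFun (f.arcParam s)
  differentiableOn := fun s hs => (f.hasDerivWithinAt_unitSpeed hs).differentiableWithinAt
  absCont := by
    obtain ⟨m, hm0, hm⟩ := f.exists_speed_lower_bound
    obtain ⟨K, hK⟩ := f.exists_lipschitz_arcParam
    have h1 := absCont_comp_of_monotoneOn f.lt.le f.length_pos.le f.absCont f.monotoneOn_arcParam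
      (fun x hx => f.arcParam_mem hx) hK
    refine absCont_of_locally_dist_le (δ₀ := 1) (K := 2 / m) one_pos (by positivity) h1 ?_
    rw [uIcc_of_le f.length_pos.le]
    intro x hx y hy _
    rw [f.derivWithin_unitSpeed hx, f.derivWithin_unitSpeed hy]
    exact dist_normalize_le hm0 (hm _ (f.arcParam_mem hx)) (f.ne_zero _ (f.arcParam_mem hy))
  ne_zero := fun s hs h0 => by
    have h := f.norm_derivWithin_unitSpeed hs
    rw [h0, norm_zero] at h
    exact zero_ne_one h

/-- Two curves are equivalent if they describe the same unit speed curve. -/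
def Equivalent (f g : PlaneCurve) : Prop :=
  f.length = g.length ∧ EqOn f.unitSpeed.toFun g.unitSpeed.toFun (Icc 0 f.length)

/-- `τ` is a direction angle of `F = [f]`: it is absolutely continuous and `F' = exp(iτ)` on
`[0, L]`. -/
def IsDirectionAngle (f : PlaneCurve) (τ : ℝ → ℝ) : Prop :=
  AbsolutelyContinuousOnInterval τ 0 f.length ∧
    ∀ s ∈ Icc 0 f.length, f.unitSpeed.vel s = Complex.exp (τ s * Complex.I)

theorem abs_sub_le_of_lift {x y : ℝ} (h : |x - y| ≤ Real.pi) :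
    dist x y ≤ Real.pi / 2 *
      dist (Complex.exp (x * Complex.I)) (Complex.exp (y * Complex.I)) := by
  have e : Complex.exp (x * Complex.I) - Complex.exp (y * Complex.I)
      = Complex.exp (y * Complex.I) * (Complex.exp (Complex.I * ((x - y : ℝ) : ℂ)) - 1) := by
    rw [mul_sub, ← Complex.exp_add, mul_one]
    congr 2
    push_cast
    ring
  rw [dist_eq_norm (Complex.exp _), e, norm_mul, Complex.norm_exp_ofReal_mul_I, one_mul,
    Complex.norm_exp_I_mul_ofReal_sub_one, Real.dist_eq]
  have h2 : |(x - y) / 2| ≤ Real.pi / 2 := by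
    rw [abs_div, abs_two]; linarith
  have h3 := Real.mul_abs_le_abs_sin h2
  rw [abs_div, abs_two] at h3
  rw [Real.norm_eq_abs, abs_mul, abs_two]
  have hpi := Real.pi_pos
  have h4 : |x - y| = Real.pi / 2 * (2 * (2 / Real.pi * (|x - y| / 2))) := by
    field_simp
  rw [h4]
  gcongr

/-- Every curve has a direction angle. -/
theorem exists_isDirectionAngle (f : PlaneCurve) : ∃ τ : ℝ → ℝ, f.IsDirectionAngle τ := by
  have hL := f.length_pos
  have hnorm : ∀ s ∈ Icc 0 f.length, ‖f.unitSpeed.vel s‖ = 1 :=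
    fun s hs => f.norm_derivWithin_unitSpeed hs
  have hcont : ContinuousOn f.unitSpeed.vel (Icc 0 f.length) := f.unitSpeed.continuousOn_vel
  have hcont' : Continuous fun s : ℝ => f.unitSpeed.vel (projIcc 0 f.length hL.le s) :=
    hcont.domRestrict.comp continuous_projIcc
  have hmem : ∀ s : ℝ,
      f.unitSpeed.vel (projIcc 0 f.length hL.le s) ∈ Submonoid.unitSphere ℂ := fun s =>
    mem_sphere_zero_iff_norm.mpr (hnorm _ (projIcc 0 f.length hL.le s).2)
  let γ : C(ℝ, Circle) := ⟨fun s => ⟨_, hmem s⟩, hcont'.subtype_mk hmem⟩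
  obtain ⟨e₀, he₀⟩ : ∃ e₀ : ℝ, Circle.exp e₀ = γ 0 :=
    ⟨Complex.arg (γ 0), Circle.exp_arg _⟩
  obtain ⟨Γ, ⟨-, hΓ⟩, -⟩ := Circle.isCoveringMap_exp.existsUnique_continuousMap_lifts γ 0 e₀ he₀
  have hlift : ∀ s ∈ Icc 0 f.length, f.unitSpeed.vel s = Complex.exp (Γ s * Complex.I) := by
    intro s hs
    have h := congrArg (fun z : Circle => (z : ℂ)) (congrFun hΓ s)
    simp only [Function.comp, Circle.coe_exp] at h
    rw [h]
    change f.unitSpeed.vel s = f.unitSpeed.vel (projIcc 0 f.length hL.le s)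
    rw [projIcc_of_mem hL.le hs]
  refine ⟨Γ, ?_, hlift⟩
  have huc : UniformContinuousOn Γ (Icc 0 f.length) :=
    isCompact_Icc.uniformContinuousOn_of_continuous Γ.continuous.continuousOn
  obtain ⟨δ, hδ, H⟩ := Metric.uniformContinuousOn_iff.mp huc Real.pi Real.pi_pos
  refine absCont_of_locally_dist_le (g := f.unitSpeed.vel) (K := Real.pi / 2) hδ
    (by positivity) f.unitSpeed.absCont ?_
  rw [uIcc_of_le hL.le]
  intro x hx y hy hxy
  rw [hlift x hx, hlift y hy]
  exact abs_sub_le_of_lift (H x hx y hy hxy).le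

/-- A direction angle of `[f]`; it is unique up to an additive constant in `2πℤ`, which does not
affect any of the notions below. -/
noncomputable def directionAngle (f : PlaneCurve) : ℝ → ℝ := f.exists_isDirectionAngle.choose

/-- The signed curvature of `[f]`, as a function of arc length (defined almost everywhere on
`[0, L]`). -/
noncomputable def signedCurvature (f : PlaneCurve) : ℝ → ℝ := deriv f.directionAngle

theorem intervalIntegrable_signedCurvature (f : PlaneCurve) :
    IntervalIntegrable f.signedCurvature volume 0 f.length :=
  f.exists_isDirectionAngle.choose_spec.1.intervalIntegrable_deriv

/-- The turning angle. -/
noncomputable def turningAngle (f : PlaneCurve) : ℝ := ∫ s in 0..f.length, f.signedCurvature s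

/-- The bending energy `¼ ∫₀ᴸ κ²`, with the value `∞` if `κ` is not square integrable. -/
noncomputable def bendingEnergy (f : PlaneCurve) : ℝ≥0∞ :=
  1 / 4 * ∫⁻ s in Icc 0 f.length, ENNReal.ofReal (f.signedCurvature s ^ 2)

/-- Left-curves turn counter-clockwise only. -/
def IsLeftCurve (f : PlaneCurve) : Prop :=
  ∀ᵐ s ∂volume.restrict (Icc 0 f.length), 0 ≤ f.signedCurvature s

/-- Right-curves turn clockwise only. -/
def IsRightCurve (f : PlaneCurve) : Prop :=
  ∀ᵐ s ∂volume.restrict (Icc 0 f.length), f.signedCurvature s ≤ 0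

/-- A left-curve turning by at most `π`. -/
def IsLeftCCurve (f : PlaneCurve) : Prop := f.IsLeftCurve ∧ |f.turningAngle| ≤ Real.pi

/-- A right-curve turning by at most `π`. -/
def IsRightCCurve (f : PlaneCurve) : Prop := f.IsRightCurve ∧ |f.turningAngle| ≤ Real.pi

/-- A c-curve. -/
def IsCCurve (f : PlaneCurve) : Prop := f.IsLeftCCurve ∨ f.IsRightCCurve

/-- `f ≡ f₁ ⊔ f₂`: the terminal unit tangent vector of `f₁` is the initial one of `f₂`, and the
unit speed curve `[f]` consists of `[f₁]` followed by `[f₂]`. -/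
def IsJoin (f₁ f₂ f : PlaneCurve) : Prop :=
  f₁.terminal = f₂.initial ∧ f.length = f₁.length + f₂.length ∧
    (∀ s ∈ Icc 0 f₁.length, f.unitSpeed.toFun s = f₁.unitSpeed.toFun s) ∧
    ∀ s ∈ Icc 0 f₂.length, f.unitSpeed.toFun (f₁.length + s) = f₂.unitSpeed.toFun s

/-- An s-curve: a c-curve, or a c-curve followed by a c-curve turning in the opposite
direction. -/
def IsSCurve (f : PlaneCurve) : Prop :=
  f.IsCCurve ∨ ∃ f₁ f₂ : PlaneCurve, IsJoin f₁ f₂ f ∧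
    (f₁.IsLeftCCurve ∧ f₂.IsRightCCurve ∨ f₁.IsRightCCurve ∧ f₂.IsLeftCCurve)

end PlaneCurve

/-- The set `S(u, v)` of all s-curves which connect `u` to `v`. -/
def sCurves (u v : UnitTangentVector) : Set PlaneCurve :=
  {f | f.IsSCurve ∧ f.Connects u v}

/-! ### Rectangular elastica -/

/-- The function `ξ` with `ξ(0) = 0` and `ξ' = sin² / √(1 + sin²)`. -/
noncomputable def elasticaXi (t : ℝ) : ℝ :=
  ∫ r in 0..t, Real.sin r ^ 2 / Real.sqrt (1 + Real.sin r ^ 2)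

/-- The rectangular elastica `E(t) = sin t + i ξ(t)`. -/
noncomputable def elastica (t : ℝ) : ℂ := Real.sin t + elasticaXi t * Complex.I

theorem continuous_elasticaXi_integrand :
    Continuous fun r : ℝ => Real.sin r ^ 2 / Real.sqrt (1 + Real.sin r ^ 2) := by
  refine Continuous.div (by fun_prop) (by fun_prop) fun r => ?_
  exact (Real.sqrt_pos.mpr (by positivity)).ne'

theorem hasDerivAt_elasticaXi (t : ℝ) :
    HasDerivAt elasticaXi (Real.sin t ^ 2 / Real.sqrt (1 + Real.sin t ^ 2)) t :=
  intervalIntegral.integral_hasDerivAt_right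
    (continuous_elasticaXi_integrand.intervalIntegrable _ _)
    (continuous_elasticaXi_integrand.stronglyMeasurableAtFilter _ _)
    continuous_elasticaXi_integrand.continuousAt

theorem hasDerivAt_elastica (t : ℝ) :
    HasDerivAt elastica (Real.cos t +
      ((Real.sin t ^ 2 / Real.sqrt (1 + Real.sin t ^ 2) : ℝ) : ℂ) * Complex.I) t :=
  (Real.hasDerivAt_sin t).ofReal_comp.add
    ((hasDerivAt_elasticaXi t).ofReal_comp.mul_const Complex.I)

theorem deriv_elastica_ne_zero (t : ℝ) : deriv elastica t ≠ 0 := by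
  rw [(hasDerivAt_elastica t).deriv]
  intro h
  have hre := congrArg Complex.re h
  have him := congrArg Complex.im h
  simp only [Complex.add_re, Complex.add_im, Complex.mul_re, Complex.mul_im, Complex.ofReal_re,
    Complex.ofReal_im, Complex.I_re, Complex.I_im, Complex.zero_re, Complex.zero_im] at hre him
  have h1 : Real.sin t ^ 2 = 1 := by nlinarith [Real.sin_sq_add_cos_sq t]
  rw [h1] at him
  have : (0 : ℝ) < 1 / Real.sqrt (1 + 1) := by positivity
  linarith

theorem contDiff_deriv_elastica : ContDiff ℝ 1 (deriv elastica) := by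
  have h : deriv elastica = fun t : ℝ => ((Real.cos t : ℝ) : ℂ) +
      ((Real.sin t ^ 2 / Real.sqrt (1 + Real.sin t ^ 2) : ℝ) : ℂ) * Complex.I :=
    funext fun t => (hasDerivAt_elastica t).deriv
  rw [h]
  have h1 : ContDiff ℝ 1 fun t : ℝ => Real.sin t ^ 2 / Real.sqrt (1 + Real.sin t ^ 2) := by
    refine ContDiff.div (Real.contDiff_sin.pow 2) (ContDiff.sqrt (by
      exact contDiff_const.add (Real.contDiff_sin.pow 2)) fun t => by positivity) fun t => ?_
    exact (Real.sqrt_pos.mpr (by positivity)).ne'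
  exact (Complex.ofRealCLM.contDiff.comp Real.contDiff_cos).add
    ((Complex.ofRealCLM.contDiff.comp h1).mul contDiff_const)

theorem derivWithin_elastica {t₁ t₂ : ℝ} (h : t₁ < t₂) {t : ℝ} (ht : t ∈ Icc t₁ t₂) :
    derivWithin elastica (Icc t₁ t₂) t = deriv elastica t :=
  (hasDerivAt_elastica t).differentiableAt.derivWithin (uniqueDiffOn_Icc h t ht)

/-- The sub-curve `E_{[t₁, t₂]}` of the rectangular elastica. -/
noncomputable def elasticaSegment (t₁ t₂ : ℝ) (h : t₁ < t₂) : PlaneCurve where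
  a := t₁
  b := t₂
  lt := h
  toFun := elastica
  differentiableOn := fun t _ => (hasDerivAt_elastica t).differentiableAt.differentiableWithinAt
  absCont := by
    refine absCont_of_locally_dist_le (δ₀ := 1) (K := 1) one_pos zero_le_one
      (contDiff_deriv_elastica.contDiffOn.absolutelyContinuousOnInterval) ?_
    rw [uIcc_of_le h.le]
    intro x hx y hy _
    rw [derivWithin_elastica h hx, derivWithin_elastica h hy, one_mul]
  ne_zero := fun t ht => by
    rw [derivWithin_elastica h ht]
    exact deriv_elastica_ne_zero t

/-- The unit tangent vector `TE(t) = (E(t), E'(t)/|E'(t)|)`. -/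
noncomputable def elasticaTangent (t : ℝ) : UnitTangentVector where
  pos := elastica t
  dir := deriv elastica t / (‖deriv elastica t‖ : ℂ)
  norm_dir := by
    have h : ‖deriv elastica t‖ ≠ 0 := norm_ne_zero_iff.mpr (deriv_elastica_ne_zero t)
    rw [norm_div, Complex.norm_real, norm_norm, div_self h]

/-!
Write the bending energy as `¼ ∫ τ'²`, where `τ` is the direction angle as a function of arc length.
For continuous `w`, the inequality `κ² / 4 ≥ w(τ) κ - w(τ)²` integrates to
`¼ ∫ τ'² ≥ ∫_{τ(0)}^{τ(L)} w - ∫ w(τ(s))² ds`, with equality if and only if `τ' = 2 w(τ)`. While `τ`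
stays in `[0, π]`, the choice `w = √ sin` turns the last integral into the height of the curve,
which is prescribed by its end points; the bound is then a constant, and it is attained exactly by
the solutions of `τ' = 2 √(sin τ)`, such as the elastica. If `τ` leaves `[0, π]`, say through `π`,
it rises to a peak and falls back, and calibrating the rise with `w` and the fall with `-w`, where
`w` is `√ sin` rotated so that its range of positivity ends at the peak, gives a strictly larger
bound.

Since `√ sin` is concave on `[0, π]`, it is one-sided Lipschitz away from `0`, so that the equation
`τ' = 2 √(sin τ)` has unique solutions forward in time as long as `τ(0) > 0`; the remaining case is
`τ(L) < π`, which the reflection `s ↦ π - τ(L - s)` reduces to the first one.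
-/

section

open Real

/-! ### Absolutely continuous functions -/

theorem integral_comp_mul_deriv_of_absCont {w τ : ℝ → ℝ} {a b : ℝ} (hw : Continuous w)
    (hτ : AbsolutelyContinuousOnInterval τ a b) :
    ∫ s in a..b, w (τ s) * deriv τ s = ∫ x in τ a..τ b, w x := by
  have hW : ∀ x, HasDerivAt (fun y => ∫ r in τ a..y, w r) (w x) x := fun x =>
    hw.integral_hasStrictDerivAt (τ a) x |>.hasDerivAt
  obtain ⟨R, hR⟩ := hτ.exists_bound
  obtain ⟨K, hK⟩ := (isCompact_Icc (a := -R) (b := R)).exists_bound_of_continuousOn hw.continuousOn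
  have hmaps : ∀ s ∈ uIcc a b, τ s ∈ Icc (-R) R := fun s hs => abs_le.mp (hR s hs)
  have hac : AbsolutelyContinuousOnInterval (fun s => ∫ r in τ a..τ s, w r) a b := by
    refine absCont_of_locally_dist_le one_pos
      ((norm_nonneg _).trans (hK _ (hmaps a left_mem_uIcc))) hτ fun x hx y hy _ => ?_
    rw [dist_eq_norm, dist_eq_norm]
    exact (convex_Icc (-R) R).norm_image_sub_le_of_norm_hasDerivWithin_le
      (fun z _ => (hW z).hasDerivWithinAt) hK (hmaps y hy) (hmaps x hx)
  have key := hac.integral_deriv_eq_sub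
  rw [intervalIntegral.integral_same, sub_zero] at key
  rw [← key]
  refine intervalIntegral.integral_congr_ae ?_
  filter_upwards [hτ.ae_differentiableAt] with s hs hsm
  exact ((hW _).comp s (hs (uIoc_subset_uIcc hsm)).hasDerivAt).deriv.symm

theorem monotoneOn_of_absCont_of_ae_deriv_nonneg {τ : ℝ → ℝ} {a b : ℝ}
    (hτ : AbsolutelyContinuousOnInterval τ a b)
    (h : ∀ᵐ s ∂volume.restrict (Icc a b), 0 ≤ deriv τ s) : MonotoneOn τ (Icc a b) := by
  intro x hx y hy hxy
  have hsub : uIcc x y ⊆ uIcc a b := (uIcc_subset_Icc hx hy).trans Icc_subset_uIcc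
  rw [← sub_nonneg, ← (hτ.mono hsub).integral_deriv_eq_sub]
  exact intervalIntegral.integral_nonneg_of_ae_restrict hxy
    (ae_restrict_of_ae_restrict_of_subset (Icc_subset_Icc hx.1 hy.2) h)

theorem hasDerivWithinAt_of_absCont_of_ae_deriv_eq {τ g : ℝ → ℝ} {a b s : ℝ}
    (hτ : AbsolutelyContinuousOnInterval τ a b) (hg : ContinuousOn g (Icc a b))
    (h : ∀ᵐ s ∂volume.restrict (Icc a b), deriv τ s = g s) (hs : s ∈ Icc a b) :
    HasDerivWithinAt τ (g s) (Icc a b) s := by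
  have hsub : ∀ x ∈ Icc a b, uIcc a x ⊆ Icc a b := fun x hx =>
    uIcc_subset_Icc (left_mem_Icc.mpr (hx.1.trans hx.2)) hx
  have key : ∀ x ∈ Icc a b, τ x = τ a + ∫ r in a..x, g r := by
    intro x hx
    have hder := (hτ.mono ((hsub x hx).trans Icc_subset_uIcc)).integral_deriv_eq_sub
    rw [← intervalIntegral.integral_congr_ae_restrict
      (ae_restrict_of_ae_restrict_of_subset (uIoc_subset_uIcc.trans (hsub x hx)) h), hder]
    ring
  have : Fact (s ∈ Icc a b) := ⟨hs⟩
  have hprim : HasDerivWithinAt (fun x => ∫ r in a..x, g r) (g s) (Icc a b) s :=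
    intervalIntegral.integral_hasDerivWithinAt_right
      (hg.mono (hsub s hs)).intervalIntegrable (t := Icc a b)
      (hg.stronglyMeasurableAtFilter_nhdsWithin measurableSet_Icc s) (hg s hs)
  exact (hprim.const_add (τ a)).congr key (key s hs)

theorem absCont_comp_const_sub {τ : ℝ → ℝ} {a b : ℝ} (c : ℝ)
    (hτ : AbsolutelyContinuousOnInterval τ a b) :
    AbsolutelyContinuousOnInterval (fun s => τ (c - s)) (c - a) (c - b) := by
  have hint := hτ.intervalIntegrable_deriv.comp_sub_left c
  refine absCont_of_locally_dist_le one_pos zero_le_one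
    (hint.absolutelyContinuousOnInterval_intervalIntegral left_mem_uIcc) fun x hx y hy _ => ?_
  have key : ∀ z ∈ uIcc (c - a) (c - b), τ (c - z) = τ a - ∫ r in c - a..z, deriv τ (c - r) := by
    intro z hz
    have hz' : c - z ∈ uIcc a b := by
      rw [mem_uIcc] at hz ⊢
      rcases hz with h | h
      · right; constructor <;> linarith
      · left; constructor <;> linarith
    rw [intervalIntegral.integral_comp_sub_left (fun r => deriv τ r), sub_sub_cancel,
      (hτ.mono (uIcc_subset_uIcc hz' left_mem_uIcc)).integral_deriv_eq_sub]
    ring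
  rw [key x hx, key y hy, dist_sub_left, one_mul]

/-! ### Bending energy of a direction angle -/

/-- The bending energy over `[a, b]` of a unit speed curve with direction angle `τ`, so that
`PlaneCurve.bendingEnergy` is the case where `a = 0` and `b` is the length. -/
noncomputable def angleEnergy (τ : ℝ → ℝ) (a b : ℝ) : ℝ≥0∞ :=
  1 / 4 * ∫⁻ s in Icc a b, ENNReal.ofReal (deriv τ s ^ 2)

theorem angleEnergy_eq_lintegral (τ : ℝ → ℝ) (a b : ℝ) :
    angleEnergy τ a b = ∫⁻ s in Icc a b, ENNReal.ofReal (deriv τ s ^ 2 / 4) := by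
  rw [angleEnergy, ← lintegral_const_mul' _ _ (by simp)]
  refine lintegral_congr fun s => ?_
  rw [div_eq_mul_inv (deriv τ s ^ 2), mul_comm, ENNReal.ofReal_mul (by positivity),
    ENNReal.ofReal_inv_of_pos (by norm_num), one_div, ENNReal.ofReal_ofNat]

theorem angleEnergy_add {τ : ℝ → ℝ} {a b c : ℝ} (hac : a ≤ c) (hcb : c ≤ b) :
    angleEnergy τ a c + angleEnergy τ c b = angleEnergy τ a b := by
  simp only [angleEnergy, ← mul_add, ← restrict_Ioc_eq_restrict_Icc]
  rw [← Ioc_union_Ioc_eq_Ioc hac hcb,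
    lintegral_union measurableSet_Ioc (Ioc_disjoint_Ioc_of_le le_rfl)]

theorem angleEnergy_const_sub_comp_const_sub (τ : ℝ → ℝ) (k L : ℝ) :
    angleEnergy (fun s => k - τ (L - s)) 0 L = angleEnergy τ 0 L := by
  have hmp : MeasurePreserving (fun s : ℝ => L - s) volume volume :=
    Measure.measurePreserving_sub_left volume L
  have hemb : MeasurableEmbedding (fun s : ℝ => L - s) :=
    (MeasurableEquiv.subLeft L).measurableEmbedding
  have hpre : (fun s : ℝ => L - s) ⁻¹' Icc 0 L = Icc 0 L := by simp
  have h := hmp.setLIntegral_comp_preimage_emb hemb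
    (fun s => ENNReal.ofReal (deriv τ s ^ 2)) (Icc 0 L)
  rw [hpre] at h
  simp only [angleEnergy, deriv_const_sub, deriv_comp_const_sub, neg_neg, h]

theorem ofReal_integral_le_lintegral_ofReal {X : Type*} [MeasurableSpace X] {μ : Measure X}
    {h k : X → ℝ} (hh : Integrable h μ) (hk : AEStronglyMeasurable k μ) (hk0 : 0 ≤ᵐ[μ] k)
    (hle : h ≤ᵐ[μ] k) : ENNReal.ofReal (∫ x, h x ∂μ) ≤ ∫⁻ x, ENNReal.ofReal (k x) ∂μ := by
  by_cases htop : ∫⁻ x, ENNReal.ofReal (k x) ∂μ = ∞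
  · exact htop ▸ le_top
  · have hki : Integrable k μ := (lintegral_ofReal_ne_top_iff_integrable hk hk0).mp htop
    rw [← ofReal_integral_eq_lintegral_ofReal hki hk0]
    exact ENNReal.ofReal_le_ofReal (integral_mono_ae hh hki hle)

theorem ae_eq_of_lintegral_ofReal_le {X : Type*} [MeasurableSpace X] {μ : Measure X}
    {h k : X → ℝ} (hh : Integrable h μ) (hk : AEStronglyMeasurable k μ) (hk0 : 0 ≤ᵐ[μ] k)
    (hle : h ≤ᵐ[μ] k) (h0 : 0 ≤ ∫ x, h x ∂μ)
    (heq : ∫⁻ x, ENNReal.ofReal (k x) ∂μ ≤ ENNReal.ofReal (∫ x, h x ∂μ)) : h =ᵐ[μ] k := by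
  have hki : Integrable k μ := (lintegral_ofReal_ne_top_iff_integrable hk hk0).mp
    (heq.trans_lt ENNReal.ofReal_lt_top).ne
  rw [← ofReal_integral_eq_lintegral_ofReal hki hk0, ENNReal.ofReal_le_ofReal_iff h0] at heq
  exact (integral_eq_iff_of_ae_le hh hki hle).mp
    (le_antisymm (integral_mono_ae hh hki hle) heq)

section Calibration

variable {w τ : ℝ → ℝ} {a b : ℝ}

theorem intervalIntegrable_calibration (hw : Continuous w)
    (hτ : AbsolutelyContinuousOnInterval τ a b) :
    IntervalIntegrable (fun s => w (τ s) * deriv τ s) volume a b ∧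
      IntervalIntegrable (fun s => w (τ s) ^ 2) volume a b := by
  have hwτ : ContinuousOn (fun s => w (τ s)) (uIcc a b) := hw.comp_continuousOn hτ.continuousOn
  exact ⟨hτ.intervalIntegrable_deriv.continuousOn_mul hwτ, (hwτ.pow 2).intervalIntegrable⟩

theorem integrableOn_calibration (hab : a ≤ b) (hw : Continuous w)
    (hτ : AbsolutelyContinuousOnInterval τ a b) :
    IntegrableOn (fun s => w (τ s) * deriv τ s - w (τ s) ^ 2) (Icc a b) := by
  obtain ⟨h₁, h₂⟩ := intervalIntegrable_calibration hw hτ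
  exact (intervalIntegrable_iff_integrableOn_Icc_of_le hab).mp (h₁.sub h₂)

theorem integral_calibration (hab : a ≤ b) (hw : Continuous w)
    (hτ : AbsolutelyContinuousOnInterval τ a b) :
    ∫ s in Icc a b, (w (τ s) * deriv τ s - w (τ s) ^ 2) =
      (∫ x in τ a..τ b, w x) - ∫ s in a..b, w (τ s) ^ 2 := by
  obtain ⟨h₁, h₂⟩ := intervalIntegrable_calibration hw hτ
  rw [integral_Icc_eq_integral_Ioc, ← intervalIntegral.integral_of_le hab,
    intervalIntegral.integral_sub h₁ h₂, integral_comp_mul_deriv_of_absCont hw hτ]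

theorem calibration_le (x y : ℝ) : x * y - x ^ 2 ≤ y ^ 2 / 4 := by
  linarith [sq_nonneg (y / 2 - x)]

theorem aestronglyMeasurable_deriv_sq_div_four (μ : Measure ℝ) :
    AEStronglyMeasurable (fun s => deriv τ s ^ 2 / 4) μ :=
  (((measurable_deriv τ).pow_const 2).div_const 4).aestronglyMeasurable

theorem ofReal_le_angleEnergy (hab : a ≤ b) (hw : Continuous w)
    (hτ : AbsolutelyContinuousOnInterval τ a b) :
    ENNReal.ofReal ((∫ x in τ a..τ b, w x) - ∫ s in a..b, w (τ s) ^ 2) ≤ angleEnergy τ a b := by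
  rw [angleEnergy_eq_lintegral, ← integral_calibration hab hw hτ]
  exact ofReal_integral_le_lintegral_ofReal (integrableOn_calibration hab hw hτ)
    (aestronglyMeasurable_deriv_sq_div_four _) (ae_of_all _ fun s => by positivity)
    (ae_of_all _ fun s => calibration_le _ _)

theorem ae_deriv_eq_of_angleEnergy_le (hab : a ≤ b) (hw : Continuous w)
    (hτ : AbsolutelyContinuousOnInterval τ a b)
    (h0 : 0 ≤ (∫ x in τ a..τ b, w x) - ∫ s in a..b, w (τ s) ^ 2)
    (hle : angleEnergy τ a b ≤
      ENNReal.ofReal ((∫ x in τ a..τ b, w x) - ∫ s in a..b, w (τ s) ^ 2)) :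
    ∀ᵐ s ∂volume.restrict (Icc a b), deriv τ s = 2 * w (τ s) := by
  rw [← integral_calibration hab hw hτ] at h0 hle
  rw [angleEnergy_eq_lintegral] at hle
  have heq := ae_eq_of_lintegral_ofReal_le (integrableOn_calibration hab hw hτ)
    (aestronglyMeasurable_deriv_sq_div_four _) (ae_of_all _ fun s => by positivity)
    (ae_of_all _ fun s => calibration_le _ _) h0 hle
  filter_upwards [heq] with s hs
  have hsq : (deriv τ s - 2 * w (τ s)) ^ 2 = 0 := by linarith
  linarith [pow_eq_zero_iff two_ne_zero |>.mp hsq]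

theorem angleEnergy_eq_of_ae_deriv_eq (hab : a ≤ b) (hw : Continuous w)
    (hτ : AbsolutelyContinuousOnInterval τ a b)
    (h : ∀ᵐ s ∂volume.restrict (Icc a b), deriv τ s = 2 * w (τ s)) :
    angleEnergy τ a b = ENNReal.ofReal (∫ s in a..b, w (τ s) ^ 2) := by
  have hint := (intervalIntegrable_iff_integrableOn_Icc_of_le hab).mp
    (intervalIntegrable_calibration hw hτ).2
  rw [angleEnergy_eq_lintegral, intervalIntegral.integral_of_le hab,
    ← integral_Icc_eq_integral_Ioc,
    ofReal_integral_eq_lintegral_ofReal hint (ae_of_all _ fun s => by positivity)]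
  refine lintegral_congr_ae ?_
  filter_upwards [h] with s hs
  rw [hs]
  ring_nf

theorem ofReal_le_angleEnergy_of_turn {c : ℝ} (hac : a ≤ c) (hcb : c ≤ b) (hw : Continuous w)
    (hτ : AbsolutelyContinuousOnInterval τ a b) :
    ENNReal.ofReal ((∫ x in τ a..τ c, w x) + (∫ x in τ b..τ c, w x) -
      ∫ s in a..b, w (τ s) ^ 2) ≤ angleEnergy τ a b := by
  have hτl : AbsolutelyContinuousOnInterval τ a c := hτ.mono (by grind [uIcc_of_le])
  have hτr : AbsolutelyContinuousOnInterval τ c b := hτ.mono (by grind [uIcc_of_le])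
  have hr := ofReal_le_angleEnergy hcb hw.neg hτr
  simp only [Pi.neg_apply, intervalIntegral.integral_neg, neg_sq,
    ← intervalIntegral.integral_symm] at hr
  rw [← angleEnergy_add hac hcb, ← intervalIntegral.integral_add_adjacent_intervals
    (intervalIntegrable_calibration hw hτl).2 (intervalIntegrable_calibration hw hτr).2]
  refine le_trans (le_trans (ENNReal.ofReal_le_ofReal (le_of_eq ?_)) ENNReal.ofReal_add_le)
    (add_le_add (ofReal_le_angleEnergy hac hw hτl) hr)
  ring

end Calibration

/-! ### The function `√ sin` and its primitive -/

/-- The primitive of `√ sin` vanishing at `0`: twice the height of the rectangular elastica at the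
point where its direction angle is `φ`. -/
noncomputable def sqrtSinPrimitive (φ : ℝ) : ℝ := ∫ r in 0..φ, √(sin r)

theorem continuous_sqrt_sin : Continuous fun r => √(sin r) := by fun_prop

theorem integral_sqrt_sin (x y : ℝ) :
    ∫ r in x..y, √(sin r) = sqrtSinPrimitive y - sqrtSinPrimitive x :=
  (intervalIntegral.integral_interval_sub_left (continuous_sqrt_sin.intervalIntegrable _ _)
    (continuous_sqrt_sin.intervalIntegrable _ _)).symm

theorem integral_sqrt_sin_sub (α x y : ℝ) :
    ∫ r in x..y, √(sin (r - α)) = sqrtSinPrimitive (y - α) - sqrtSinPrimitive (x - α) := by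
  rw [intervalIntegral.integral_comp_sub_right (fun r => √(sin r)), integral_sqrt_sin]

theorem hasDerivAt_sqrtSinPrimitive (φ : ℝ) :
    HasDerivAt sqrtSinPrimitive (√(sin φ)) φ :=
  (continuous_sqrt_sin.integral_hasStrictDerivAt 0 φ).hasDerivAt

theorem monotone_sqrtSinPrimitive : Monotone sqrtSinPrimitive := fun x y hxy => by
  rw [← sub_nonneg, ← integral_sqrt_sin]
  exact intervalIntegral.integral_nonneg hxy fun r _ => sqrt_nonneg _

theorem strictMonoOn_sqrtSinPrimitive : StrictMonoOn sqrtSinPrimitive (Icc 0 π) := by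
  refine strictMonoOn_of_deriv_pos (convex_Icc _ _)
    (fun φ _ => (hasDerivAt_sqrtSinPrimitive φ).continuousAt.continuousWithinAt) fun φ hφ => ?_
  rw [interior_Icc] at hφ
  rw [(hasDerivAt_sqrtSinPrimitive φ).deriv]
  exact sqrt_pos.mpr (sin_pos_of_mem_Ioo hφ)

theorem sqrtSinPrimitive_pi_sub (φ : ℝ) :
    sqrtSinPrimitive (π - φ) = sqrtSinPrimitive π - sqrtSinPrimitive φ := by
  have h := intervalIntegral.integral_comp_sub_left (a := φ) (b := π) (fun r => √(sin r)) π
  simp only [sin_pi_sub, integral_sqrt_sin, sub_self] at h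
  rw [h, show sqrtSinPrimitive 0 = 0 from intervalIntegral.integral_same, sub_zero]

theorem concaveOn_sqrt_sin : ConcaveOn ℝ (Icc 0 π) fun x => √(sin x) := by
  refine ⟨convex_Icc _ _, fun x hx y hy a b ha hb hab => ?_⟩
  refine (strictConcaveOn_sqrt.concaveOn.2 (sin_nonneg_of_mem_Icc hx) (sin_nonneg_of_mem_Icc hy)
    ha hb hab).trans ?_
  exact sqrt_le_sqrt (strictConcaveOn_sin_Icc.concaveOn.2 hx hy ha hb hab)

theorem le_add_of_concaveOn_Icc {f : ℝ → ℝ} {R u v : ℝ} (hf : ConcaveOn ℝ (Icc 0 R) f)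
    (h0 : 0 ≤ f 0) (hu : 0 ≤ u) (hv : 0 ≤ v) (huv : u + v ≤ R) : f (u + v) ≤ f u + f v := by
  rcases (add_nonneg hu hv).eq_or_lt with h | hpos
  · rw [← h, show u = 0 by linarith, show v = 0 by linarith]
    linarith
  · have hmem : u + v ∈ Icc 0 R := ⟨hpos.le, huv⟩
    have hmem0 : (0 : ℝ) ∈ Icc 0 R := ⟨le_rfl, hpos.le.trans huv⟩
    have hsum : u / (u + v) + v / (u + v) = 1 := by field_simp
    have hcu := hf.2 hmem hmem0 (div_nonneg hu hpos.le) (div_nonneg hv hpos.le) hsum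
    have hcv := hf.2 hmem0 hmem (div_nonneg hu hpos.le) (div_nonneg hv hpos.le) hsum
    simp only [smul_eq_mul, mul_zero, add_zero, zero_add, div_mul_cancel₀ _ hpos.ne'] at hcu hcv
    linear_combination hcu + hcv + h0 - (f (u + v) + f 0) * hsum

theorem sqrt_sin_sub_le {θ x y : ℝ} (hθ : 0 < θ) (hx : θ ≤ x) (hxy : x ≤ y) (hy : y ≤ π) :
    √(sin y) - √(sin x) ≤ θ⁻¹ * (y - x) := by
  rcases hxy.eq_or_lt with rfl | hlt
  · simp
  · have hslope := concaveOn_sqrt_sin.slope_anti_adjacent (x := 0) ⟨le_rfl, pi_pos.le⟩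
      ⟨by linarith, hy⟩ (hθ.trans_le hx) hlt
    rw [← div_le_iff₀ (sub_pos.mpr hlt)]
    calc (√(sin y) - √(sin x)) / (y - x) ≤ (√(sin x) - √(sin 0)) / (x - 0) := hslope
      _ ≤ 1 / θ := by
        rw [sin_zero, sqrt_zero, sub_zero, sub_zero]
        exact div_le_div₀ zero_le_one (sqrt_le_one.mpr (sin_le_one x)) hθ hx
      _ = θ⁻¹ := one_div θ

theorem sqrt_sin_le_sqrt_sin_sub_add {θ₁ θ₂ α : ℝ} (hα : 0 ≤ α) (hα₁ : α ≤ θ₁) (h₁₂ : θ₁ ≤ θ₂)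
    (h₂ : θ₂ ≤ π) :
    √(sin θ₁) ≤ √(sin (θ₁ - α)) + √(sin (θ₂ - α)) + √(sin θ₂) := by
  obtain ⟨p, q, hp, hq, hpq, rfl⟩ : θ₂ ∈ segment ℝ θ₁ π := by
    rw [segment_eq_Icc (h₁₂.trans h₂)]
    exact ⟨h₁₂, h₂⟩
  have hsum := le_add_of_concaveOn_Icc concaveOn_sqrt_sin (sqrt_nonneg _) (sub_nonneg.mpr hα₁) hα
    (by linarith)
  have hc := concaveOn_sqrt_sin.2 (x := θ₁) (y := π) ⟨by linarith, by linarith⟩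
    ⟨pi_pos.le, le_rfl⟩ hp hq hpq
  have hcα := concaveOn_sqrt_sin.2 (x := θ₁ - α) (y := π - α) ⟨by linarith, by linarith⟩
    ⟨by linarith, by linarith⟩ hp hq hpq
  have hshift : p • (θ₁ - α) + q • (π - α) = p • θ₁ + q • π - α := by
    simp only [smul_eq_mul]
    linear_combination -α * hpq
  simp only [hshift, sin_pi_sub, sin_pi, sqrt_zero, sub_add_cancel] at hsum hc hcα
  simp only [smul_eq_mul] at hsum hc hcα ⊢
  linear_combination hc + hcα + q * hsum + 2 * mul_nonneg hp (sqrt_nonneg (sin (θ₁ - α)))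
    + (√(sin (θ₁ - α)) - √(sin θ₁)) * hpq

theorem cos_mul_sqrt_sin_sub_le {θ₁ θ₂ α : ℝ} (hα : 0 ≤ α) (hα₁ : α ≤ θ₁) (h₁₂ : θ₁ ≤ θ₂)
    (h₂ : θ₂ ≤ π) :
    cos α * (√(sin θ₁) - √(sin θ₂)) ≤ √(sin (θ₁ - α)) + √(sin (θ₂ - α)) := by
  have hkey := sqrt_sin_le_sqrt_sin_sub_add hα hα₁ h₁₂ h₂
  have hnonneg := add_nonneg (sqrt_nonneg (sin (θ₁ - α))) (sqrt_nonneg (sin (θ₂ - α)))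
  rcases le_total (√(sin θ₂)) (√(sin θ₁)) with hle | hle
  · linarith [mul_le_of_le_one_left (sub_nonneg.mpr hle) (cos_le_one α)]
  · suffices cos α * (√(sin θ₁) - √(sin θ₂)) ≤ 0 by linarith
    rcases le_or_gt α (π / 2) with hα₂ | hα₂
    · exact mul_nonpos_of_nonneg_of_nonpos (cos_nonneg_of_mem_Icc ⟨by linarith, hα₂⟩)
        (sub_nonpos.mpr hle)
    · have hanti : sin θ₂ ≤ sin θ₁ := by
        rw [← cos_sub_pi_div_two, ← cos_sub_pi_div_two]
        exact cos_le_cos_of_nonneg_of_le_pi (by linarith) (by linarith) (by linarith)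
      rw [hle.antisymm (sqrt_le_sqrt hanti), sub_self, mul_zero]

theorem half_sub_lt_overshoot {θ₁ θ₂ α : ℝ} (hα : 0 < α) (hα₁ : α ≤ θ₁) (h₁₂ : θ₁ < θ₂)
    (h₂ : θ₂ ≤ π) :
    (sqrtSinPrimitive θ₂ - sqrtSinPrimitive θ₁) / 2 <
      sqrtSinPrimitive π - sqrtSinPrimitive (θ₁ - α) +
        (sqrtSinPrimitive π - sqrtSinPrimitive (θ₂ - α)) -
        (cos α * ((sqrtSinPrimitive θ₂ - sqrtSinPrimitive θ₁) / 2) -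
          sin α * (√(sin θ₂) - √(sin θ₁))) := by
  set Δ := (sqrtSinPrimitive θ₂ - sqrtSinPrimitive θ₁) / 2 with hΔ
  set d := √(sin θ₂) - √(sin θ₁) with hd
  have hΔ_pos : 0 < Δ := half_pos (sub_pos.mpr
    (strictMonoOn_sqrtSinPrimitive ⟨by linarith, by linarith⟩ ⟨by linarith, h₂⟩ h₁₂))
  let h : ℝ → ℝ := fun x => sqrtSinPrimitive π - sqrtSinPrimitive (θ₁ - x) +
    (sqrtSinPrimitive π - sqrtSinPrimitive (θ₂ - x)) - (cos x * Δ - sin x * d)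
  have hP : ∀ θ x, HasDerivAt (fun x => sqrtSinPrimitive π - sqrtSinPrimitive (θ - x))
      (√(sin (θ - x))) x := fun θ x => by
    simpa using ((hasDerivAt_sqrtSinPrimitive (θ - x)).comp_const_sub θ x).const_sub
      (sqrtSinPrimitive π)
  have hder : ∀ x, HasDerivAt h
      (√(sin (θ₁ - x)) + √(sin (θ₂ - x)) + sin x * Δ + cos x * d) x := fun x =>
    (((hP θ₁ x).add (hP θ₂ x)).sub (((hasDerivAt_cos x).mul_const Δ).sub
      ((hasDerivAt_sin x).mul_const d))).congr_deriv (by ring)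
  have hmono : StrictMonoOn h (Icc 0 θ₁) := by
    refine strictMonoOn_of_deriv_pos (convex_Icc _ _)
      (fun x _ => (hder x).continuousAt.continuousWithinAt) fun x hx => ?_
    rw [interior_Icc] at hx
    rw [(hder x).deriv]
    have hsin : 0 < sin x * Δ :=
      mul_pos (sin_pos_of_pos_of_lt_pi hx.1 (by linarith [hx.2])) hΔ_pos
    have hcos := cos_mul_sqrt_sin_sub_le hx.1.le hx.2.le h₁₂.le h₂
    linear_combination hsin + hcos + cos x * hd
  calc Δ ≤ h 0 := by
        have := monotone_sqrtSinPrimitive h₂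
        simp only [h, sub_zero, cos_zero, sin_zero]
        linarith
    _ < h α := hmono ⟨le_rfl, hα.le.trans hα₁⟩ ⟨hα.le, hα₁⟩ hα

/-- The point of the rectangular elastica at which its direction angle is `θ ∈ [0, π]`. -/
noncomputable def elasticaOfAngle (θ : ℝ) : ℂ := √(sin θ) + sqrtSinPrimitive θ / 2 * Complex.I

/-- The height gained by the rectangular elastica while its direction angle grows from `θ₁` to
`θ₂`. Since the elastica satisfies `κ = 2 √(sin τ)`, this is also the bending energy of that arc. -/
noncomputable def elasticaEnergy (θ₁ θ₂ : ℝ) : ℝ :=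
  (sqrtSinPrimitive θ₂ - sqrtSinPrimitive θ₁) / 2

theorem elasticaEnergy_pos {θ₁ θ₂ : ℝ} (h₁ : 0 ≤ θ₁) (h₁₂ : θ₁ < θ₂) (h₂ : θ₂ ≤ π) :
    0 < elasticaEnergy θ₁ θ₂ :=
  half_pos (sub_pos.mpr (strictMonoOn_sqrtSinPrimitive
    ⟨h₁, by linarith⟩ ⟨by linarith, h₂⟩ h₁₂))

theorem elasticaEnergy_pi_sub (θ₁ θ₂ : ℝ) :
    elasticaEnergy (π - θ₂) (π - θ₁) = elasticaEnergy θ₁ θ₂ := by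
  simp only [elasticaEnergy, sqrtSinPrimitive_pi_sub]
  ring

/-! ### Direction angles of s-curves -/

/-- The direction angles on `[0, L]` of a left c-curve followed by a right c-curve. Either part may
be degenerate. -/
def RisesThenFalls (τ : ℝ → ℝ) (L : ℝ) : Prop :=
  ∃ c ∈ Icc 0 L, MonotoneOn τ (Icc 0 c) ∧ AntitoneOn τ (Icc c L) ∧
    τ c - τ 0 ≤ π ∧ τ c - τ L ≤ π

namespace RisesThenFalls

variable {τ : ℝ → ℝ} {L : ℝ}

theorem exists_peak (h : RisesThenFalls τ L) :
    ∃ c ∈ Icc 0 L, τ c - τ 0 ≤ π ∧ τ c - τ L ≤ π ∧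
      ∀ s ∈ Icc 0 L, τ s ∈ Icc (min (τ 0) (τ L)) (τ c) := by
  obtain ⟨c, hc, hmono, hanti, h0, hL⟩ := h
  refine ⟨c, hc, h0, hL, fun s hs => ?_⟩
  rcases le_total s c with hsc | hcs
  · exact ⟨min_le_of_left_le (hmono ⟨le_rfl, hc.1⟩ ⟨hs.1, hsc⟩ hs.1),
      hmono ⟨hs.1, hsc⟩ ⟨hc.1, le_rfl⟩ hsc⟩
  · exact ⟨min_le_of_right_le (hanti ⟨hcs, hs.2⟩ ⟨hc.2, le_rfl⟩ hs.2),
      hanti ⟨le_rfl, hc.2⟩ ⟨hcs, hs.2⟩ hcs⟩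

theorem abs_sub_le (h : RisesThenFalls τ L) : |τ L - τ 0| ≤ π := by
  obtain ⟨c, hc, h0, hL, hpeak⟩ := h.exists_peak
  have hL0 : 0 ≤ L := hc.1.trans hc.2
  rw [abs_le]
  constructor <;> linarith [(hpeak 0 ⟨le_rfl, hL0⟩).2, (hpeak L ⟨hL0, le_rfl⟩).2]

theorem add_const (h : RisesThenFalls τ L) (k : ℝ) : RisesThenFalls (fun s => τ s + k) L := by
  obtain ⟨c, hc, hmono, hanti, h0, hL⟩ := h
  exact ⟨c, hc, hmono.add_const k, hanti.add_const k, by linarith, by linarith⟩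

theorem comp_const_sub (h : RisesThenFalls τ L) : RisesThenFalls (fun s => τ (L - s)) L := by
  obtain ⟨c, hc, hmono, hanti, h0, hL⟩ := h
  refine ⟨L - c, ⟨by linarith [hc.2], by linarith [hc.1]⟩, fun x hx y hy hxy => ?_,
    fun x hx y hy hxy => ?_, by simpa using hL, by simpa using h0⟩
  · exact hanti ⟨by linarith [hy.2], by linarith [hy.1]⟩ ⟨by linarith [hx.2], by linarith [hx.1]⟩
      (by linarith)
  · exact hmono ⟨by linarith [hy.2], by linarith [hy.1]⟩ ⟨by linarith [hx.2], by linarith [hx.1]⟩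
      (by linarith)

end RisesThenFalls

/-- The direction angle of the curve traversed backwards and reflected in a horizontal line: the
symmetry of the elastica. -/
noncomputable def reflectAngle (L : ℝ) (τ : ℝ → ℝ) (s : ℝ) : ℝ := π - τ (L - s)

theorem angleEnergy_reflectAngle (L : ℝ) (τ : ℝ → ℝ) :
    angleEnergy (reflectAngle L τ) 0 L = angleEnergy τ 0 L :=
  angleEnergy_const_sub_comp_const_sub τ π L

theorem risesThenFalls_reflectAngle {τ : ℝ → ℝ} {L : ℝ} (h : RisesThenFalls (fun s => -τ s) L) :
    RisesThenFalls (reflectAngle L τ) L := by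
  convert h.comp_const_sub.add_const π using 2
  rw [reflectAngle]
  ring

/-- `τ` is the direction angle of a unit speed s-curve of length `L` with the same end points and
the same end directions as the arc of the rectangular elastica with direction angles from `θ₁` to
`θ₂`. -/
structure IsAdmissibleAngle (θ₁ θ₂ L : ℝ) (τ : ℝ → ℝ) : Prop where
  length_nonneg : 0 ≤ L
  absCont : AbsolutelyContinuousOnInterval τ 0 L
  left : τ 0 = θ₁
  right : τ L = θ₂
  turn : RisesThenFalls τ L ∨ RisesThenFalls (fun s => -τ s) L
  integral_cos : ∫ s in 0..L, cos (τ s) = √(sin θ₂) - √(sin θ₁)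
  integral_sin : ∫ s in 0..L, sin (τ s) = elasticaEnergy θ₁ θ₂

/-- `τ` solves on `[0, L]`, with values in `[0, π]`, the equation `κ = 2 √(sin τ)` which
characterizes the rectangular elastica. -/
def IsElasticaAngle (L : ℝ) (τ : ℝ → ℝ) : Prop :=
  ∀ s ∈ Icc 0 L, τ s ∈ Icc 0 π ∧ HasDerivWithinAt τ (2 * √(sin (τ s))) (Icc 0 L) s

namespace IsAdmissibleAngle

variable {θ₁ θ₂ L : ℝ} {τ : ℝ → ℝ}

theorem reflect (h : IsAdmissibleAngle θ₁ θ₂ L τ) :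
    IsAdmissibleAngle (π - θ₂) (π - θ₁) L (reflectAngle L τ) where
  length_nonneg := h.length_nonneg
  absCont := by
    have hac := absCont_comp_const_sub L h.absCont
    rw [sub_zero, sub_self] at hac
    refine absCont_of_locally_dist_le one_pos zero_le_one hac.symm fun x _ y _ _ => ?_
    rw [one_mul, reflectAngle, reflectAngle, dist_sub_left]
  left := by rw [reflectAngle, sub_zero, h.right]
  right := by rw [reflectAngle, sub_self, h.left]
  turn := by
    rcases h.turn with hτ | hτ
    · refine Or.inr ?_
      convert hτ.comp_const_sub.add_const (-π) using 2
      rw [reflectAngle]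
      ring
    · exact Or.inl (risesThenFalls_reflectAngle hτ)
  integral_cos := by
    simp only [reflectAngle, cos_pi_sub, sin_pi_sub, intervalIntegral.integral_neg]
    rw [intervalIntegral.integral_comp_sub_left (fun s => cos (τ s)), sub_self, sub_zero,
      h.integral_cos, neg_sub]
  integral_sin := by
    simp only [reflectAngle, sin_pi_sub]
    rw [intervalIntegral.integral_comp_sub_left (fun s => sin (τ s)), sub_self, sub_zero,
      h.integral_sin, elasticaEnergy_pi_sub]

theorem integral_sin_sub (h : IsAdmissibleAngle θ₁ θ₂ L τ) (α : ℝ) :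
    ∫ s in 0..L, sin (τ s - α) =
      cos α * elasticaEnergy θ₁ θ₂ - sin α * (√(sin θ₂) - √(sin θ₁)) := by
  have hcos : IntervalIntegrable (fun s => cos (τ s)) volume 0 L :=
    (continuous_cos.comp_continuousOn h.absCont.continuousOn).intervalIntegrable
  have hsin : IntervalIntegrable (fun s => sin (τ s)) volume 0 L :=
    (continuous_sin.comp_continuousOn h.absCont.continuousOn).intervalIntegrable
  simp only [sin_sub, mul_comm _ (cos α), mul_comm _ (sin α)]
  rw [intervalIntegral.integral_sub (hsin.const_mul _) (hcos.const_mul _),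
    intervalIntegral.integral_const_mul, intervalIntegral.integral_const_mul, h.integral_cos,
    h.integral_sin]

theorem integral_sq_sqrt_sin_sub (h : IsAdmissibleAngle θ₁ θ₂ L τ) {α : ℝ}
    (hα : ∀ s ∈ Icc 0 L, τ s ∈ Icc α (α + π)) :
    ∫ s in 0..L, √(sin (τ s - α)) ^ 2 =
      cos α * elasticaEnergy θ₁ θ₂ - sin α * (√(sin θ₂) - √(sin θ₁)) := by
  rw [← h.integral_sin_sub]
  refine intervalIntegral.integral_congr fun s hs => sq_sqrt (sin_nonneg_of_mem_Icc ?_)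
  rw [uIcc_of_le h.length_nonneg] at hs
  exact ⟨sub_nonneg.mpr (hα s hs).1, by linarith [(hα s hs).2]⟩

theorem le_pi_or_lt_angleEnergy (h : IsAdmissibleAngle θ₁ θ₂ L τ) (h₁₂ : θ₁ < θ₂) (h₂ : θ₂ ≤ π)
    (hτ : RisesThenFalls τ L) :
    (∀ s ∈ Icc 0 L, τ s ∈ Icc θ₁ π) ∨
      ENNReal.ofReal (elasticaEnergy θ₁ θ₂) < angleEnergy τ 0 L := by
  obtain ⟨c, hc, h0, -, hpeak⟩ := hτ.exists_peak
  rw [h.left, h.right, min_eq_left h₁₂.le] at hpeak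
  rw [h.left] at h0
  refine (le_or_gt (τ c) π).imp (fun hcπ s hs => ⟨(hpeak s hs).1, (hpeak s hs).2.trans hcπ⟩)
    fun hcπ => ?_
  -- Calibrate with `√ sin` rotated so that its range of positivity ends at the peak of `τ`.
  obtain ⟨α, hα⟩ : ∃ α, τ c = α + π := ⟨τ c - π, by ring⟩
  have hrange : ∀ s ∈ Icc 0 L, τ s ∈ Icc α (α + π) := fun s hs =>
    ⟨by linarith [(hpeak s hs).1], hα ▸ (hpeak s hs).2⟩
  have hcal := ofReal_le_angleEnergy_of_turn hc.1 hc.2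
    (by fun_prop : Continuous fun x => √(sin (x - α))) h.absCont
  rw [integral_sqrt_sin_sub, integral_sqrt_sin_sub, h.integral_sq_sqrt_sin_sub hrange, hα,
    add_sub_cancel_left, h.left, h.right] at hcal
  have hlt := half_sub_lt_overshoot (by linarith) (by linarith) h₁₂ h₂
  exact ((ENNReal.ofReal_lt_ofReal_iff
    ((elasticaEnergy_pos (by linarith [pi_pos]) h₁₂ h₂).trans hlt)).mpr hlt).trans_le hcal

theorem mem_Icc_or_lt_angleEnergy (h : IsAdmissibleAngle θ₁ θ₂ L τ) (h₁ : 0 ≤ θ₁) (h₁₂ : θ₁ < θ₂)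
    (h₂ : θ₂ ≤ π) :
    (∀ s ∈ Icc 0 L, τ s ∈ Icc 0 π) ∨
      ENNReal.ofReal (elasticaEnergy θ₁ θ₂) < angleEnergy τ 0 L := by
  rcases h.turn with hτ | hτ
  · exact (h.le_pi_or_lt_angleEnergy h₁₂ h₂ hτ).imp_left
      fun H s hs => Icc_subset_Icc_left h₁ (H s hs)
  · refine (h.reflect.le_pi_or_lt_angleEnergy (by linarith) (by linarith)
      (risesThenFalls_reflectAngle hτ)).imp (fun H s hs => ?_) fun H => ?_
    · have hs' := H (L - s) ⟨sub_nonneg.mpr hs.2, by linarith [hs.1]⟩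
      simp only [reflectAngle, sub_sub_cancel, mem_Icc] at hs'
      exact ⟨by linarith, by linarith⟩
    · rwa [elasticaEnergy_pi_sub, angleEnergy_reflectAngle] at H

theorem calibration_sqrt_sin_eq (h : IsAdmissibleAngle θ₁ θ₂ L τ)
    (hrange : ∀ s ∈ Icc 0 L, τ s ∈ Icc 0 π) :
    (∫ x in τ 0..τ L, √(sin x)) - ∫ s in 0..L, √(sin (τ s)) ^ 2 = elasticaEnergy θ₁ θ₂ := by
  have hsq := h.integral_sq_sqrt_sin_sub (α := 0) (by simpa using hrange)
  simp only [sub_zero, cos_zero, sin_zero, one_mul, zero_mul] at hsq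
  rw [hsq, integral_sqrt_sin, h.left, h.right, elasticaEnergy]
  ring

theorem ofReal_elasticaEnergy_le (h : IsAdmissibleAngle θ₁ θ₂ L τ) (h₁ : 0 ≤ θ₁) (h₁₂ : θ₁ < θ₂)
    (h₂ : θ₂ ≤ π) : ENNReal.ofReal (elasticaEnergy θ₁ θ₂) ≤ angleEnergy τ 0 L := by
  rcases h.mem_Icc_or_lt_angleEnergy h₁ h₁₂ h₂ with hrange | hlt
  · rw [← h.calibration_sqrt_sin_eq hrange]
    exact ofReal_le_angleEnergy h.length_nonneg continuous_sqrt_sin h.absCont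
  · exact hlt.le

theorem isElasticaAngle_of_angleEnergy_le (h : IsAdmissibleAngle θ₁ θ₂ L τ) (h₁ : 0 ≤ θ₁)
    (h₁₂ : θ₁ < θ₂) (h₂ : θ₂ ≤ π)
    (hle : angleEnergy τ 0 L ≤ ENNReal.ofReal (elasticaEnergy θ₁ θ₂)) :
    IsElasticaAngle L τ := by
  have hrange := (h.mem_Icc_or_lt_angleEnergy h₁ h₁₂ h₂).resolve_right hle.not_gt
  rw [← h.calibration_sqrt_sin_eq hrange] at hle
  have hae := ae_deriv_eq_of_angleEnergy_le h.length_nonneg continuous_sqrt_sin h.absCont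
    (by rw [h.calibration_sqrt_sin_eq hrange]; exact (elasticaEnergy_pos h₁ h₁₂ h₂).le) hle
  have hcont : ContinuousOn τ (Icc 0 L) := uIcc_of_le h.length_nonneg ▸ h.absCont.continuousOn
  exact fun s hs => ⟨hrange s hs,
    hasDerivWithinAt_of_absCont_of_ae_deriv_eq h.absCont (by fun_prop) hae hs⟩

end IsAdmissibleAngle

/-! ### Uniqueness of the minimizing direction angle -/

theorem integral_eq_add_of_eqOn {f g : ℝ → ℝ} {a b c k : ℝ} (hab : a ≤ b) (hbc : b ≤ c)
    (hg : ContinuousOn g (Icc a c)) (hfg : EqOn f g (Icc a b)) (hk : ∀ s ∈ Icc b c, g s = k) :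
    ∫ s in a..c, g s = (∫ s in a..b, f s) + (c - b) * k := by
  have ha : a ∈ Icc a c := ⟨le_rfl, hab.trans hbc⟩
  have hc : c ∈ Icc a c := ⟨hab.trans hbc, le_rfl⟩
  rw [← intervalIntegral.integral_add_adjacent_intervals
      (hg.mono (uIcc_subset_Icc ha ⟨hab, hbc⟩)).intervalIntegrable
      (hg.mono (uIcc_subset_Icc ⟨hab, hbc⟩ hc)).intervalIntegrable,
    intervalIntegral.integral_congr (fun s hs => hfg (uIcc_of_le hab ▸ hs)),
    intervalIntegral.integral_congr (g := fun _ => k) (fun s hs => hk s (uIcc_of_le hbc ▸ hs)),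
    intervalIntegral.integral_const, smul_eq_mul]

/- `v` is Lipschitz from above only, so the Picard–Lindelöf uniqueness theorem does not apply:
solutions are unique forwards, though not backwards, in time. -/
theorem eqOn_of_hasDerivWithinAt_of_sub_le {v τ ρ : ℝ → ℝ} {S : Set ℝ} {K L : ℝ}
    (hv : ∀ x ∈ S, ∀ y ∈ S, x ≤ y → v y - v x ≤ K * (y - x))
    (hτS : MapsTo τ (Icc 0 L) S) (hρS : MapsTo ρ (Icc 0 L) S)
    (hτ : ∀ s ∈ Icc 0 L, HasDerivWithinAt τ (v (τ s)) (Icc 0 L) s)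
    (hρ : ∀ s ∈ Icc 0 L, HasDerivWithinAt ρ (v (ρ s)) (Icc 0 L) s) (h0 : τ 0 = ρ 0) :
    EqOn τ ρ (Icc 0 L) := by
  intro s hs
  have hder : ∀ r ∈ Icc 0 L, HasDerivWithinAt (fun r => (τ r - ρ r) ^ 2 * exp (-2 * K * r))
      (2 * ((τ r - ρ r) * (v (τ r) - v (ρ r)) - K * (τ r - ρ r) ^ 2) * exp (-2 * K * r))
      (Icc 0 L) r := fun r hr => by
    have hexp : HasDerivAt (fun r => exp (-2 * K * r)) (exp (-2 * K * r) * (-2 * K)) r := by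
      simpa using ((hasDerivAt_id r).const_mul (-2 * K)).exp
    refine ((((hτ r hr).sub (hρ r hr)).pow 2).mul hexp.hasDerivWithinAt).congr_deriv ?_
    simp only [Pi.pow_apply, Pi.sub_apply]
    ring
  have hsign : ∀ x ∈ S, ∀ y ∈ S, (x - y) * (v x - v y) ≤ K * (x - y) ^ 2 := by
    intro x hx y hy
    rcases le_total x y with hxy | hxy
    · linear_combination mul_le_mul_of_nonneg_left (hv x hx y hy hxy) (sub_nonneg.mpr hxy)
    · linear_combination mul_le_mul_of_nonneg_left (hv y hy x hx hxy) (sub_nonneg.mpr hxy)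
  have hanti : AntitoneOn (fun r => (τ r - ρ r) ^ 2 * exp (-2 * K * r)) (Icc 0 L) :=
    antitoneOn_of_hasDerivWithinAt_nonpos (convex_Icc 0 L)
      (fun r hr => (hder r hr).continuousWithinAt)
      (fun r hr => (hder r (interior_subset hr)).mono interior_subset) fun r hr => by
        have := hsign _ (hτS (interior_subset hr)) _ (hρS (interior_subset hr))
        exact mul_nonpos_of_nonpos_of_nonneg (by linarith) (exp_pos _).le
  have hle := hanti ⟨le_rfl, hs.1.trans hs.2⟩ hs hs.1
  simp only [h0, sub_self, ne_eq, OfNat.ofNat_ne_zero, not_false_eq_true, zero_pow,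
    zero_mul] at hle
  have hsq : (τ s - ρ s) ^ 2 = 0 :=
    le_antisymm (nonpos_of_mul_nonpos_left hle (exp_pos _)) (sq_nonneg _)
  exact sub_eq_zero.mp (pow_eq_zero_iff two_ne_zero |>.mp hsq)

namespace IsElasticaAngle

variable {τ ρ : ℝ → ℝ} {L L' : ℝ}

theorem mono (h : IsElasticaAngle L τ) (hL : L' ≤ L) : IsElasticaAngle L' τ := fun s hs =>
  have hsub : Icc 0 L' ⊆ Icc 0 L := Icc_subset_Icc_right hL
  ⟨(h s (hsub hs)).1, (h s (hsub hs)).2.mono hsub⟩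

theorem monotoneOn (h : IsElasticaAngle L τ) : MonotoneOn τ (Icc 0 L) :=
  monotoneOn_of_hasDerivWithinAt_nonneg (convex_Icc 0 L)
    (fun s hs => (h s hs).2.continuousWithinAt)
    (fun s hs => (h s (interior_subset hs)).2.mono interior_subset) fun s _ => by positivity

theorem eqOn (hτ : IsElasticaAngle L τ) (hρ : IsElasticaAngle L ρ) (h0 : τ 0 = ρ 0)
    (hpos : 0 < τ 0) : EqOn τ ρ (Icc 0 L) := by
  have hmaps : ∀ {σ : ℝ → ℝ}, IsElasticaAngle L σ → σ 0 = τ 0 →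
      MapsTo σ (Icc 0 L) (Icc (τ 0) π) := fun hσ hσ0 s hs =>
    ⟨hσ0 ▸ hσ.monotoneOn ⟨le_rfl, hs.1.trans hs.2⟩ hs hs.1, (hσ s hs).1.2⟩
  refine eqOn_of_hasDerivWithinAt_of_sub_le (v := fun x => 2 * √(sin x)) (K := 2 * (τ 0)⁻¹)
    (fun x hx y hy hxy => ?_) (hmaps hτ rfl) (hmaps hρ h0.symm) (fun s hs => (hτ s hs).2)
    (fun s hs => (hρ s hs).2) h0
  linear_combination 2 * sqrt_sin_sub_le hpos hx.1 hxy hy.2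

end IsElasticaAngle

namespace IsAdmissibleAngle

variable {θ₁ θ₂ L₁ L₂ : ℝ} {τ₁ τ₂ : ℝ → ℝ}

theorem length_eq_of_eqOn (h₁ : IsAdmissibleAngle θ₁ θ₂ L₁ τ₁) (h₂ : IsAdmissibleAngle θ₁ θ₂ L₂ τ₂)
    (hL : L₁ ≤ L₂) (hτ : EqOn τ₁ τ₂ (Icc 0 L₁)) (hmono : MonotoneOn τ₂ (Icc 0 L₂)) : L₁ = L₂ := by
  have hL₁ := h₁.length_nonneg
  have hconst : ∀ s ∈ Icc L₁ L₂, τ₂ s = θ₂ := fun s hs => by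
    refine le_antisymm (h₂.right ▸ hmono ⟨hL₁.trans hs.1, hs.2⟩ ⟨hL₁.trans hL, le_rfl⟩ hs.2) ?_
    rw [← h₁.right, hτ ⟨hL₁, le_rfl⟩]
    exact hmono ⟨hL₁, hL⟩ ⟨hL₁.trans hs.1, hs.2⟩ hs.1
  have hcont : ContinuousOn τ₂ (Icc 0 L₂) := uIcc_of_le h₂.length_nonneg ▸ h₂.absCont.continuousOn
  have hcos := integral_eq_add_of_eqOn (f := fun s => cos (τ₁ s)) (k := cos θ₂) hL₁ hL
    (continuous_cos.comp_continuousOn hcont) (fun s hs => by simp only [Function.comp, hτ hs])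
    fun s hs => by simp only [Function.comp, hconst s hs]
  have hsin := integral_eq_add_of_eqOn (f := fun s => sin (τ₁ s)) (k := sin θ₂) hL₁ hL
    (continuous_sin.comp_continuousOn hcont) (fun s hs => by simp only [Function.comp, hτ hs])
    fun s hs => by simp only [Function.comp, hconst s hs]
  simp only [Function.comp, h₁.integral_cos, h₂.integral_cos] at hcos
  simp only [Function.comp, h₁.integral_sin, h₂.integral_sin] at hsin
  linear_combination cos θ₂ * hcos + sin θ₂ * hsin - (L₁ - L₂) * sin_sq_add_cos_sq θ₂

theorem eqOn_of_isElasticaAngle (h₁ : IsAdmissibleAngle θ₁ θ₂ L₁ τ₁)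
    (h₂ : IsAdmissibleAngle θ₁ θ₂ L₂ τ₂) (hθ₁ : 0 < θ₁) (hτ₁ : IsElasticaAngle L₁ τ₁)
    (hτ₂ : IsElasticaAngle L₂ τ₂) : L₁ = L₂ ∧ EqOn τ₁ τ₂ (Icc 0 L₁) := by
  wlog hL : L₁ ≤ L₂ generalizing L₁ L₂ τ₁ τ₂
  · obtain ⟨rfl, heq⟩ := this h₂ h₁ hτ₂ hτ₁ (le_of_not_ge hL)
    exact ⟨rfl, heq.symm⟩
  have heq := hτ₁.eqOn (hτ₂.mono hL) (h₁.left.trans h₂.left.symm) (h₁.left ▸ hθ₁)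
  exact ⟨length_eq_of_eqOn h₁ h₂ hL heq hτ₂.monotoneOn, heq⟩

theorem eqOn_of_angleEnergy_le (h₁ : IsAdmissibleAngle θ₁ θ₂ L₁ τ₁)
    (h₂ : IsAdmissibleAngle θ₁ θ₂ L₂ τ₂) (hθ₁ : 0 ≤ θ₁) (hθ : θ₁ < θ₂) (hθ₂ : θ₂ ≤ π)
    (hlt : θ₂ - θ₁ < π) (hle₁ : angleEnergy τ₁ 0 L₁ ≤ ENNReal.ofReal (elasticaEnergy θ₁ θ₂))
    (hle₂ : angleEnergy τ₂ 0 L₂ ≤ ENNReal.ofReal (elasticaEnergy θ₁ θ₂)) :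
    L₁ = L₂ ∧ EqOn τ₁ τ₂ (Icc 0 L₁) := by
  rcases hθ₁.lt_or_eq with hpos | rfl
  · exact h₁.eqOn_of_isElasticaAngle h₂ hpos (h₁.isElasticaAngle_of_angleEnergy_le hθ₁ hθ hθ₂ hle₁)
      (h₂.isElasticaAngle_of_angleEnergy_le hθ₁ hθ hθ₂ hle₂)
  · have hflow : ∀ {L τ}, IsAdmissibleAngle 0 θ₂ L τ →
        angleEnergy τ 0 L ≤ ENNReal.ofReal (elasticaEnergy 0 θ₂) →
        IsElasticaAngle L (reflectAngle L τ) := fun h hle =>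
      h.reflect.isElasticaAngle_of_angleEnergy_le (by linarith) (by linarith) (by linarith)
        (by rwa [angleEnergy_reflectAngle, elasticaEnergy_pi_sub])
    obtain ⟨rfl, heq⟩ := h₁.reflect.eqOn_of_isElasticaAngle h₂.reflect (by linarith)
      (hflow h₁ hle₁) (hflow h₂ hle₂)
    refine ⟨rfl, fun s hs => ?_⟩
    have hs' := heq (x := L₁ - s) ⟨sub_nonneg.mpr hs.2, by linarith [hs.1]⟩
    simpa only [reflectAngle, sub_sub_cancel, sub_right_inj] using hs'

end IsAdmissibleAngle

/-! ### Direction angles of plane curves -/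

theorem exp_mul_I_eq_exp_mul_I_iff {x y : ℝ} :
    Complex.exp (x * Complex.I) = Complex.exp (y * Complex.I) ↔ ∃ k : ℤ, x = y + k * (2 * π) := by
  rw [Complex.exp_eq_exp_iff_exists_int]
  refine exists_congr fun k => ?_
  rw [← Complex.ofReal_inj]
  push_cast
  rw [← mul_assoc, ← mul_assoc, ← add_mul, mul_left_inj' Complex.I_ne_zero, mul_assoc]

theorem exists_int_eq_add_of_exp_eq {α β : ℝ → ℝ} {a b : ℝ}
    (hα : ContinuousOn α (Icc a b)) (hβ : ContinuousOn β (Icc a b))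
    (h : ∀ s ∈ Icc a b, Complex.exp (α s * Complex.I) = Complex.exp (β s * Complex.I)) :
    ∃ k : ℤ, ∀ s ∈ Icc a b, α s = β s + k * (2 * π) := by
  have hmaps : MapsTo (fun s => α s - β s) (Icc a b)
      (AddSubgroup.zmultiples (2 * π) : Set ℝ) := fun s hs => by
    obtain ⟨n, hn⟩ := exp_mul_I_eq_exp_mul_I_iff.mp (h s hs)
    exact ⟨n, by simp [hn]⟩
  have hdisc : IsDiscrete (AddSubgroup.zmultiples (2 * π) : Set ℝ) :=
    ⟨inferInstanceAs (DiscreteTopology (AddSubgroup.zmultiples (2 * π)))⟩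
  obtain ⟨-, ⟨k, rfl⟩, hk⟩ :=
    isPreconnected_Icc.eqOn_const_of_mapsTo hdisc (hα.sub hβ) hmaps ⟨0, zero_mem _⟩
  exact ⟨k, fun s hs => by rw [← sub_eq_iff_eq_add']; simpa using hk hs⟩

namespace PlaneCurve

theorem arcParam_zero (f : PlaneCurve) : f.arcParam 0 = f.a := by
  rw [← f.arcLength_left]
  exact f.strictMonoOn_arcLength.injOn.leftInvOn_invFunOn (left_mem_Icc.mpr f.lt.le)

theorem arcParam_length (f : PlaneCurve) : f.arcParam f.length = f.b :=
  f.strictMonoOn_arcLength.injOn.leftInvOn_invFunOn (right_mem_Icc.mpr f.lt.le)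

theorem arcParam_mem_Ioo (f : PlaneCurve) {s : ℝ} (hs : s ∈ Ioo 0 f.length) :
    f.arcParam s ∈ Ioo f.a f.b := by
  have hs' := Ioo_subset_Icc_self hs
  refine ⟨(f.arcParam_mem hs').1.lt_of_ne fun h => ?_, (f.arcParam_mem hs').2.lt_of_ne fun h => ?_⟩
  · have := f.arcLength_arcParam hs'
    rw [← h, f.arcLength_left] at this
    exact hs.1.ne this
  · have := f.arcLength_arcParam hs'
    rw [h] at this
    exact hs.2.ne this.symm

theorem continuousOn_arcParam (f : PlaneCurve) :
    ContinuousOn f.arcParam (Icc 0 f.length) :=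
  f.exists_lipschitz_arcParam.choose_spec.continuousOn

theorem hasDerivAt_arcParam (f : PlaneCurve) {s : ℝ} (hs : s ∈ Ioo 0 f.length) :
    HasDerivAt f.arcParam ‖f.vel (f.arcParam s)‖⁻¹ s := by
  have hnhds : Icc 0 f.length ∈ 𝓝 s := Icc_mem_nhds hs.1 hs.2
  have hp := f.arcParam_mem_Ioo hs
  have hp' := Ioo_subset_Icc_self hp
  exact HasDerivAt.of_local_left_inverse (f.continuousOn_arcParam.continuousAt hnhds)
    ((f.hasDerivWithinAt_arcLength hp').hasDerivAt (Icc_mem_nhds hp.1 hp.2))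
    (norm_ne_zero_iff.mpr (f.ne_zero _ hp'))
    (eventually_of_mem hnhds fun x hx => f.arcLength_arcParam hx)

theorem zero_mem_Icc_length (f : PlaneCurve) : 0 ∈ Icc 0 f.length := ⟨le_rfl, f.length_pos.le⟩

theorem length_mem_Icc_length (f : PlaneCurve) : f.length ∈ Icc 0 f.length :=
  ⟨f.length_pos.le, le_rfl⟩

theorem unitSpeed_vel (f : PlaneCurve) {s : ℝ} (hs : s ∈ Icc 0 f.length) :
    f.unitSpeed.vel s = f.vel (f.arcParam s) / (‖f.vel (f.arcParam s)‖ : ℂ) :=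
  f.derivWithin_unitSpeed hs

theorem hasDerivWithinAt_unitSpeed_toFun (f : PlaneCurve) {s : ℝ} (hs : s ∈ Icc 0 f.length) :
    HasDerivWithinAt f.unitSpeed.toFun (f.unitSpeed.vel s) (Icc 0 f.length) s :=
  (f.unitSpeed.differentiableOn s hs).hasDerivWithinAt

theorem initial_pos (f : PlaneCurve) : f.initial.pos = f.unitSpeed.toFun 0 :=
  congrArg f.toFun f.arcParam_zero.symm

theorem terminal_pos (f : PlaneCurve) : f.terminal.pos = f.unitSpeed.toFun f.length :=
  congrArg f.toFun f.arcParam_length.symm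

theorem initial_dir (f : PlaneCurve) : f.initial.dir = f.unitSpeed.vel 0 := by
  rw [f.unitSpeed_vel f.zero_mem_Icc_length, arcParam_zero]
  rfl

theorem terminal_dir (f : PlaneCurve) : f.terminal.dir = f.unitSpeed.vel f.length := by
  rw [f.unitSpeed_vel f.length_mem_Icc_length, arcParam_length]
  rfl

theorem isDirectionAngle_directionAngle (f : PlaneCurve) :
    f.IsDirectionAngle f.directionAngle := f.exists_isDirectionAngle.choose_spec

variable {f g : PlaneCurve} {τ σ : ℝ → ℝ}

theorem IsDirectionAngle.continuousOn (h : f.IsDirectionAngle τ) :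
    ContinuousOn τ (Icc 0 f.length) :=
  uIcc_of_le f.length_pos.le ▸ h.1.continuousOn

theorem exists_int_directionAngle_eq_add (hτ : ContinuousOn τ (Icc 0 f.length))
    (h : ∀ s ∈ Icc 0 f.length, f.unitSpeed.vel s = Complex.exp (τ s * Complex.I)) :
    ∃ k : ℤ, ∀ s ∈ Icc 0 f.length, f.directionAngle s = τ s + k * (2 * π) :=
  exists_int_eq_add_of_exp_eq f.isDirectionAngle_directionAngle.continuousOn hτ
    fun s hs => by rw [← f.isDirectionAngle_directionAngle.2 s hs, h s hs]

namespace IsDirectionAngle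

theorem exists_int_eq_add_of_subarc (hτ : f.IsDirectionAngle τ) (hσ : g.IsDirectionAngle σ) {c : ℝ}
    (hc : 0 ≤ c) (hcg : c + g.length ≤ f.length)
    (h : ∀ s ∈ Icc 0 g.length, f.unitSpeed.toFun (c + s) = g.unitSpeed.toFun s) :
    ∃ k : ℤ, ∀ s ∈ Icc 0 g.length, τ (c + s) = σ s + k * (2 * π) := by
  have hmaps : MapsTo (fun s => c + s) (Icc 0 g.length) (Icc 0 f.length) :=
    fun s hs => ⟨by linarith [hs.1], by linarith [hs.2]⟩
  refine exists_int_eq_add_of_exp_eq (hτ.continuousOn.comp (by fun_prop) hmaps)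
    hσ.continuousOn fun s hs => ?_
  rw [← hτ.2 _ (hmaps hs), ← hσ.2 s hs]
  have hf := ((f.hasDerivWithinAt_unitSpeed_toFun (hmaps hs)).scomp s
    ((hasDerivWithinAt_id s _).const_add c) hmaps).congr_of_mem (fun r hr => (h r hr).symm) hs
  rw [one_smul] at hf
  exact (uniqueDiffOn_Icc g.length_pos s hs).eq_deriv _ hf (g.hasDerivWithinAt_unitSpeed_toFun hs)

theorem of_continuousOn (hτ : ContinuousOn τ (Icc 0 f.length))
    (h : ∀ s ∈ Icc 0 f.length, f.unitSpeed.vel s = Complex.exp (τ s * Complex.I)) :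
    f.IsDirectionAngle τ := by
  obtain ⟨k, hk⟩ := exists_int_directionAngle_eq_add hτ h
  refine ⟨absCont_of_locally_dist_le one_pos zero_le_one f.isDirectionAngle_directionAngle.1
    fun x hx y hy _ => ?_, h⟩
  rw [uIcc_of_le f.length_pos.le] at hx hy
  rw [hk x hx, hk y hy, dist_add_right, one_mul]

theorem add_int (h : f.IsDirectionAngle τ) (k : ℤ) :
    f.IsDirectionAngle (fun s => τ s + k * (2 * π)) :=
  of_continuousOn (h.continuousOn.add continuousOn_const) fun s hs =>
    (h.2 s hs).trans (exp_mul_I_eq_exp_mul_I_iff.mpr ⟨-k, by push_cast; ring⟩)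

theorem signedCurvature_ae_eq (h : f.IsDirectionAngle τ) :
    f.signedCurvature =ᵐ[volume.restrict (Icc 0 f.length)] deriv τ := by
  obtain ⟨k, hk⟩ := exists_int_directionAngle_eq_add h.continuousOn h.2
  rw [← restrict_Ioo_eq_restrict_Icc]
  filter_upwards [ae_restrict_mem measurableSet_Ioo] with s hs
  have hev : f.directionAngle =ᶠ[𝓝 s] fun r => τ r + k * (2 * π) :=
    eventually_of_mem (Icc_mem_nhds hs.1 hs.2) hk
  rw [signedCurvature, hev.deriv_eq, deriv_add_const]

theorem turningAngle_eq (h : f.IsDirectionAngle τ) : f.turningAngle = τ f.length - τ 0 := by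
  obtain ⟨k, hk⟩ := exists_int_directionAngle_eq_add h.continuousOn h.2
  have hturn : f.turningAngle = f.directionAngle f.length - f.directionAngle 0 :=
    f.isDirectionAngle_directionAngle.1.integral_deriv_eq_sub
  rw [hturn, hk _ f.length_mem_Icc_length, hk _ f.zero_mem_Icc_length]
  ring

theorem bendingEnergy_eq (h : f.IsDirectionAngle τ) :
    f.bendingEnergy = angleEnergy τ 0 f.length := by
  rw [bendingEnergy, angleEnergy]
  congr 1
  refine lintegral_congr_ae ?_
  filter_upwards [h.signedCurvature_ae_eq] with s hs
  rw [hs]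

theorem toFun_sub_eq_integral (h : f.IsDirectionAngle τ) {s : ℝ} (hs : s ∈ Icc 0 f.length) :
    f.unitSpeed.toFun s - f.unitSpeed.toFun 0 = ∫ r in 0..s, Complex.exp (τ r * Complex.I) := by
  have hsub : Icc 0 s ⊆ Icc 0 f.length := Icc_subset_Icc_right hs.2
  have hcont : ContinuousOn (fun r => Complex.exp (τ r * Complex.I)) (Icc 0 s) :=
    ((Complex.continuous_ofReal.comp_continuousOn (h.continuousOn.mono hsub)).mul_const _).cexp
  refine (intervalIntegral.integral_eq_sub_of_hasDerivAt_of_le hs.1 (fun r hr => ?_)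
    (fun r hr => ?_) (hcont.intervalIntegrable_of_Icc hs.1)).symm
  · exact (f.hasDerivWithinAt_unitSpeed_toFun (hsub hr)).continuousWithinAt.mono hsub
  · rw [← h.2 r (hsub (Ioo_subset_Icc_self hr))]
    exact (f.hasDerivWithinAt_unitSpeed_toFun (hsub (Ioo_subset_Icc_self hr))).hasDerivAt
      (Icc_mem_nhds hr.1 (hr.2.trans_le hs.2))

theorem equivalent (hτ : f.IsDirectionAngle τ) (hσ : g.IsDirectionAngle σ)
    (hlen : f.length = g.length) (heq : EqOn τ σ (Icc 0 f.length))
    (h0 : f.initial.pos = g.initial.pos) : f.Equivalent g := by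
  refine ⟨hlen, fun s hs => ?_⟩
  have hint : ∫ r in 0..s, Complex.exp (τ r * Complex.I) =
      ∫ r in 0..s, Complex.exp (σ r * Complex.I) :=
    intervalIntegral.integral_congr fun r hr => by
      simp only [heq (uIcc_subset_Icc f.zero_mem_Icc_length hs hr)]
  rw [← hτ.toFun_sub_eq_integral hs, ← hσ.toFun_sub_eq_integral (hlen ▸ hs), ← f.initial_pos,
    ← g.initial_pos, h0] at hint
  exact sub_left_injective hint

end IsDirectionAngle

end PlaneCurve

/-! ### s-curves connecting tangent vectors of the rectangular elastica -/

theorem risesThenFalls_of_monotoneOn {τ : ℝ → ℝ} {L : ℝ} (hL : 0 ≤ L)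
    (hτ : MonotoneOn τ (Icc 0 L)) (h : τ L - τ 0 ≤ π) : RisesThenFalls τ L :=
  ⟨L, ⟨hL, le_rfl⟩, hτ, by simp, h, by simp [pi_pos.le]⟩

theorem risesThenFalls_add {τ τ₁ τ₂ : ℝ → ℝ} {L₁ L₂ k₁ k₂ : ℝ} (hL₁ : 0 ≤ L₁) (hL₂ : 0 ≤ L₂)
    (h₁ : MonotoneOn τ₁ (Icc 0 L₁)) (hπ₁ : τ₁ L₁ - τ₁ 0 ≤ π)
    (h₂ : AntitoneOn τ₂ (Icc 0 L₂)) (hπ₂ : τ₂ 0 - τ₂ L₂ ≤ π)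
    (heq₁ : ∀ s ∈ Icc 0 L₁, τ s = τ₁ s + k₁) (heq₂ : ∀ s ∈ Icc 0 L₂, τ (L₁ + s) = τ₂ s + k₂) :
    RisesThenFalls τ (L₁ + L₂) := by
  have heq₂' : ∀ s ∈ Icc L₁ (L₁ + L₂), s - L₁ ∈ Icc 0 L₂ ∧ τ s = τ₂ (s - L₁) + k₂ := fun s hs => by
    have hs' : s - L₁ ∈ Icc 0 L₂ := ⟨by linarith [hs.1], by linarith [hs.2]⟩
    exact ⟨hs', by rw [← heq₂ _ hs', add_sub_cancel]⟩
  refine ⟨L₁, ⟨hL₁, by linarith⟩, fun x hx y hy hxy => ?_, fun x hx y hy hxy => ?_, ?_, ?_⟩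
  · rw [heq₁ x hx, heq₁ y hy]
    exact add_le_add_left (h₁ hx hy hxy) k₁
  · obtain ⟨hx', hτx⟩ := heq₂' x hx
    obtain ⟨hy', hτy⟩ := heq₂' y hy
    rw [hτx, hτy]
    exact add_le_add_left (h₂ hx' hy' (sub_le_sub_right hxy L₁)) k₂
  · rwa [heq₁ L₁ ⟨hL₁, le_rfl⟩, heq₁ 0 ⟨le_rfl, hL₁⟩, add_sub_add_right_eq_sub]
  · have h0 := heq₂ 0 ⟨le_rfl, hL₂⟩
    rw [add_zero] at h0
    rwa [h0, heq₂ L₂ ⟨hL₂, le_rfl⟩, add_sub_add_right_eq_sub]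

namespace PlaneCurve

variable {f : PlaneCurve} {τ : ℝ → ℝ}

theorem IsDirectionAngle.isLeftCCurve_iff (h : f.IsDirectionAngle τ) :
    f.IsLeftCCurve ↔ MonotoneOn τ (Icc 0 f.length) ∧ τ f.length - τ 0 ≤ π := by
  rw [IsLeftCCurve, h.turningAngle_eq]
  refine ⟨fun ⟨hleft, hπ⟩ => ⟨monotoneOn_of_absCont_of_ae_deriv_nonneg h.1 ?_, (abs_le.mp hπ).2⟩,
    fun ⟨hmono, hπ⟩ => ⟨?_, ?_⟩⟩
  · filter_upwards [hleft, h.signedCurvature_ae_eq] with s hs hs'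
    exact hs' ▸ hs
  · have hderiv : ∀ᵐ s ∂volume.restrict (Icc 0 f.length), 0 ≤ deriv τ s := by
      rw [← restrict_Ioo_eq_restrict_Icc]
      filter_upwards [ae_restrict_mem measurableSet_Ioo] with s hs
      rw [← derivWithin_of_mem_nhds (Icc_mem_nhds hs.1 hs.2)]
      exact hmono.derivWithin_nonneg
    filter_upwards [hderiv, h.signedCurvature_ae_eq] with s hs hs'
    exact hs'.symm ▸ hs
  · rwa [abs_of_nonneg (sub_nonneg.mpr
      (hmono f.zero_mem_Icc_length f.length_mem_Icc_length f.length_pos.le))]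

theorem IsDirectionAngle.antitoneOn_of_isRightCCurve (h : f.IsDirectionAngle τ)
    (hf : f.IsRightCCurve) : AntitoneOn τ (Icc 0 f.length) ∧ τ 0 - τ f.length ≤ π := by
  obtain ⟨hright, hπ⟩ := hf
  rw [h.turningAngle_eq, abs_sub_comm] at hπ
  have hmono := monotoneOn_of_absCont_of_ae_deriv_nonneg h.1.fun_neg <| by
    filter_upwards [hright, h.signedCurvature_ae_eq] with s hs hs'
    rw [deriv.fun_neg, ← hs']
    exact neg_nonneg.mpr hs
  exact ⟨fun x hx y hy hxy => neg_le_neg_iff.mp (hmono hx hy hxy), (abs_le.mp hπ).2⟩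

theorem IsDirectionAngle.risesThenFalls_of_isSCurve (h : f.IsDirectionAngle τ) (hf : f.IsSCurve) :
    RisesThenFalls τ f.length ∨ RisesThenFalls (fun s => -τ s) f.length := by
  rcases hf with (hleft | hright) | ⟨f₁, f₂, ⟨-, hlen, hjoin₁, hjoin₂⟩, hturn⟩
  · obtain ⟨hmono, hπ⟩ := h.isLeftCCurve_iff.mp hleft
    exact Or.inl (risesThenFalls_of_monotoneOn f.length_pos.le hmono hπ)
  · obtain ⟨hanti, hπ⟩ := h.antitoneOn_of_isRightCCurve hright
    exact Or.inr (risesThenFalls_of_monotoneOn f.length_pos.le hanti.neg (by linarith))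
  have hL₁ := f₁.length_pos.le
  have hL₂ := f₂.length_pos.le
  have hτ₁ := f₁.isDirectionAngle_directionAngle
  have hτ₂ := f₂.isDirectionAngle_directionAngle
  obtain ⟨k₁, heq₁⟩ := h.exists_int_eq_add_of_subarc hτ₁ le_rfl (by linarith)
    (by simpa only [zero_add] using hjoin₁)
  obtain ⟨k₂, heq₂⟩ := h.exists_int_eq_add_of_subarc hτ₂ hL₁ hlen.ge hjoin₂
  simp only [zero_add] at heq₁
  rw [hlen]
  refine hturn.imp (fun ⟨hleft, hright⟩ => ?_) fun ⟨hright, hleft⟩ => ?_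
  · obtain ⟨hmono, hπ₁⟩ := hτ₁.isLeftCCurve_iff.mp hleft
    obtain ⟨hanti, hπ₂⟩ := hτ₂.antitoneOn_of_isRightCCurve hright
    exact risesThenFalls_add hL₁ hL₂ hmono hπ₁ hanti hπ₂ heq₁ heq₂
  · obtain ⟨hanti, hπ₁⟩ := hτ₁.antitoneOn_of_isRightCCurve hright
    obtain ⟨hmono, hπ₂⟩ := hτ₂.isLeftCCurve_iff.mp hleft
    exact risesThenFalls_add hL₁ hL₂ hanti.neg (by linarith) hmono.neg (by linarith)
      (fun s hs => by rw [heq₁ s hs, neg_add]) fun s hs => by rw [heq₂ s hs, neg_add]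

end PlaneCurve

/-- The unit tangent vector to the rectangular elastica at the point with direction angle `θ`. -/
noncomputable def elasticaTangentOfAngle (θ : ℝ) : UnitTangentVector where
  pos := elasticaOfAngle θ
  dir := Complex.exp (θ * Complex.I)
  norm_dir := Complex.norm_exp_ofReal_mul_I θ

namespace PlaneCurve

variable {f : PlaneCurve} {τ : ℝ → ℝ} {θ₁ θ₂ : ℝ}

theorem IsDirectionAngle.integral_cos_sin_of_connects (h : f.IsDirectionAngle τ)
    (hf : f.Connects (elasticaTangentOfAngle θ₁) (elasticaTangentOfAngle θ₂)) :
    ∫ s in 0..f.length, cos (τ s) = √(sin θ₂) - √(sin θ₁) ∧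
      ∫ s in 0..f.length, sin (τ s) = elasticaEnergy θ₁ θ₂ := by
  have hchord : elasticaOfAngle θ₂ - elasticaOfAngle θ₁ =
      ∫ s in 0..f.length, Complex.exp (τ s * Complex.I) := by
    rw [← h.toFun_sub_eq_integral f.length_mem_Icc_length, ← f.initial_pos, ← f.terminal_pos,
      hf.1, hf.2]
    rfl
  have hint : IntervalIntegrable (fun s => Complex.exp (τ s * Complex.I)) volume 0 f.length :=
    ((Complex.continuous_ofReal.comp_continuousOn h.continuousOn).mul_const
      _).cexp.intervalIntegrable_of_Icc f.length_pos.le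
  have hre := Complex.reCLM.intervalIntegral_comp_comm hint
  have him := Complex.imCLM.intervalIntegral_comp_comm hint
  simp only [← hchord, Complex.reCLM_apply, Complex.exp_ofReal_mul_I_re] at hre
  simp only [← hchord, Complex.imCLM_apply, Complex.exp_ofReal_mul_I_im] at him
  refine ⟨hre.trans (by simp [elasticaOfAngle]), him.trans ?_⟩
  simp [elasticaOfAngle, elasticaEnergy, sub_div]

theorem IsDirectionAngle.isAdmissibleAngle (h : f.IsDirectionAngle τ) (h₁₂ : θ₁ < θ₂)
    (hlt : θ₂ - θ₁ < π)
    (hf : f ∈ sCurves (elasticaTangentOfAngle θ₁) (elasticaTangentOfAngle θ₂))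
    (hleft : τ 0 = θ₁) : IsAdmissibleAngle θ₁ θ₂ f.length τ where
  length_nonneg := f.length_pos.le
  absCont := h.1
  left := hleft
  right := by
    obtain ⟨k, hk⟩ : ∃ k : ℤ, τ f.length = θ₂ + k * (2 * π) := by
      rw [← exp_mul_I_eq_exp_mul_I_iff, ← h.2 _ f.length_mem_Icc_length, ← f.terminal_dir, hf.2.2]
      rfl
    have hturn : |τ f.length - τ 0| ≤ π := by
      rcases h.risesThenFalls_of_isSCurve hf.1 with hτ | hτ
      · exact hτ.abs_sub_le
      · simpa only [neg_sub_neg, abs_sub_comm] using hτ.abs_sub_le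
    rw [hk, hleft, abs_le] at hturn
    have hk_lt : (k : ℝ) < 1 := by nlinarith [pi_pos]
    have hlt_k : (-1 : ℝ) < k := by nlinarith [pi_pos]
    obtain rfl : k = 0 := by
      have : k < 1 := by exact_mod_cast hk_lt
      have : -1 < k := by exact_mod_cast hlt_k
      lia
    simpa using hk
  turn := h.risesThenFalls_of_isSCurve hf.1
  integral_cos := (h.integral_cos_sin_of_connects hf.2).1
  integral_sin := (h.integral_cos_sin_of_connects hf.2).2

theorem exists_isAdmissibleAngle (h₁₂ : θ₁ < θ₂) (hlt : θ₂ - θ₁ < π)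
    (hf : f ∈ sCurves (elasticaTangentOfAngle θ₁) (elasticaTangentOfAngle θ₂)) :
    ∃ τ, f.IsDirectionAngle τ ∧ IsAdmissibleAngle θ₁ θ₂ f.length τ := by
  have hτ := f.isDirectionAngle_directionAngle
  obtain ⟨k, hk⟩ : ∃ k : ℤ, θ₁ = f.directionAngle 0 + k * (2 * π) := by
    rw [← exp_mul_I_eq_exp_mul_I_iff, ← hτ.2 0 f.zero_mem_Icc_length, ← f.initial_dir, hf.2.1]
    rfl
  exact ⟨_, hτ.add_int k, (hτ.add_int k).isAdmissibleAngle h₁₂ hlt hf hk.symm⟩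

theorem ofReal_elasticaEnergy_le_bendingEnergy (h₁ : 0 ≤ θ₁) (h₁₂ : θ₁ < θ₂) (h₂ : θ₂ ≤ π)
    (hlt : θ₂ - θ₁ < π)
    (hf : f ∈ sCurves (elasticaTangentOfAngle θ₁) (elasticaTangentOfAngle θ₂)) :
    ENNReal.ofReal (elasticaEnergy θ₁ θ₂) ≤ f.bendingEnergy := by
  obtain ⟨τ, hfτ, hτ⟩ := exists_isAdmissibleAngle h₁₂ hlt hf
  exact hfτ.bendingEnergy_eq ▸ hτ.ofReal_elasticaEnergy_le h₁ h₁₂ h₂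

theorem equivalent_of_bendingEnergy_le {g : PlaneCurve} (h₁ : 0 ≤ θ₁) (h₁₂ : θ₁ < θ₂) (h₂ : θ₂ ≤ π)
    (hlt : θ₂ - θ₁ < π)
    (hf : f ∈ sCurves (elasticaTangentOfAngle θ₁) (elasticaTangentOfAngle θ₂))
    (hg : g ∈ sCurves (elasticaTangentOfAngle θ₁) (elasticaTangentOfAngle θ₂))
    (hle_f : f.bendingEnergy ≤ ENNReal.ofReal (elasticaEnergy θ₁ θ₂))
    (hle_g : g.bendingEnergy ≤ ENNReal.ofReal (elasticaEnergy θ₁ θ₂)) : f.Equivalent g := by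
  obtain ⟨τ, hfτ, hτ⟩ := exists_isAdmissibleAngle h₁₂ hlt hf
  obtain ⟨σ, hgσ, hσ⟩ := exists_isAdmissibleAngle h₁₂ hlt hg
  obtain ⟨hlen, heq⟩ := hτ.eqOn_of_angleEnergy_le hσ h₁ h₁₂ h₂ hlt
    (hfτ.bendingEnergy_eq ▸ hle_f) (hgσ.bendingEnergy_eq ▸ hle_g)
  exact hfτ.equivalent hgσ hlen heq (by rw [hf.2.1, hg.2.1])

end PlaneCurve

/-! ### The direction angle of the rectangular elastica -/

/-- The direction angle of the rectangular elastica at the parameter `t ∈ [0, π]`, characterized by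
`cos θ = cos t √(1 + sin² t)` and `sin θ = sin² t`. -/
noncomputable def elasticaAngle (t : ℝ) : ℝ := arccos (cos t * √(1 + sin t ^ 2))

variable {t t₁ t₂ : ℝ}

theorem sqrt_one_add_sin_sq_pos (t : ℝ) : 0 < √(1 + sin t ^ 2) := sqrt_pos.mpr (by positivity)

theorem one_sub_sq_cos_mul_sqrt (t : ℝ) :
    1 - (cos t * √(1 + sin t ^ 2)) ^ 2 = (sin t ^ 2) ^ 2 := by
  rw [mul_pow, sq_sqrt (by positivity), cos_sq']
  ring

theorem cos_elasticaAngle (t : ℝ) : cos (elasticaAngle t) = cos t * √(1 + sin t ^ 2) := by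
  have h : |cos t * √(1 + sin t ^ 2)| ≤ 1 :=
    (sq_le_one_iff_abs_le_one _).mp (by linarith [one_sub_sq_cos_mul_sqrt t, sq_nonneg (sin t ^ 2)])
  exact cos_arccos (abs_le.mp h).1 (abs_le.mp h).2

theorem sin_elasticaAngle (t : ℝ) : sin (elasticaAngle t) = sin t ^ 2 := by
  rw [elasticaAngle, sin_arccos, one_sub_sq_cos_mul_sqrt, sqrt_sq (sq_nonneg _)]

theorem sqrt_sin_elasticaAngle (ht : t ∈ Icc 0 π) : √(sin (elasticaAngle t)) = sin t := by
  rw [sin_elasticaAngle, sqrt_sq (sin_nonneg_of_mem_Icc ht)]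

theorem elasticaAngle_mem_Icc (t : ℝ) : elasticaAngle t ∈ Icc 0 π :=
  ⟨arccos_nonneg _, arccos_le_pi _⟩

theorem elasticaAngle_zero : elasticaAngle 0 = 0 := by simp [elasticaAngle]

theorem elasticaAngle_pi : elasticaAngle π = π := by simp [elasticaAngle]

theorem continuous_elasticaAngle : Continuous elasticaAngle :=
  continuous_arccos.comp (by fun_prop)

theorem hasDerivAt_cos_mul_sqrt (t : ℝ) :
    HasDerivAt (fun t => cos t * √(1 + sin t ^ 2))
      (-(sin t ^ 2 * (2 * sin t / √(1 + sin t ^ 2)))) t := by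
  have hsqrt := (((hasDerivAt_sin t).pow 2).const_add 1).sqrt
    (by positivity : 1 + sin t ^ 2 ≠ 0)
  refine ((hasDerivAt_cos t).mul hsqrt).congr_deriv ?_
  have hne := (sqrt_one_add_sin_sq_pos t).ne'
  have hsq : √(1 + sin t ^ 2) ^ 2 = 1 + sin t ^ 2 := sq_sqrt (by positivity)
  simp only [Pi.pow_apply]
  field_simp
  norm_num
  rw [hsq]
  linear_combination (2 * sin t) * sin_sq_add_cos_sq t

theorem hasDerivAt_elasticaAngle (ht : t ∈ Ioo 0 π) :
    HasDerivAt elasticaAngle (2 * sin t / √(1 + sin t ^ 2)) t := by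
  have hsin : 0 < sin t ^ 2 := pow_pos (sin_pos_of_mem_Ioo ht) 2
  have hsub := one_sub_sq_cos_mul_sqrt t
  refine ((hasDerivAt_arccos ?_ ?_).comp t (hasDerivAt_cos_mul_sqrt t)).congr_deriv ?_
  · rintro h
    rw [h] at hsub
    nlinarith
  · rintro h
    rw [h] at hsub
    nlinarith
  · rw [hsub, sqrt_sq hsin.le]
    field_simp

theorem strictMonoOn_elasticaAngle : StrictMonoOn elasticaAngle (Icc 0 π) := by
  refine strictMonoOn_of_deriv_pos (convex_Icc _ _) continuous_elasticaAngle.continuousOn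
    fun t ht => ?_
  rw [interior_Icc] at ht
  rw [(hasDerivAt_elasticaAngle ht).deriv]
  exact div_pos (mul_pos two_pos (sin_pos_of_mem_Ioo ht)) (sqrt_one_add_sin_sq_pos t)

theorem elasticaAngle_sub_lt_pi (h₀ : 0 ≤ t₁) (h₁₂ : t₁ < t₂) (h₂ : t₂ ≤ π) (hlt : t₂ - t₁ < π) :
    elasticaAngle t₂ - elasticaAngle t₁ < π := by
  have hmem₁ : t₁ ∈ Icc 0 π := ⟨h₀, h₁₂.le.trans h₂⟩
  have hmem₂ : t₂ ∈ Icc 0 π := ⟨h₀.trans h₁₂.le, h₂⟩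
  rcases h₀.eq_or_lt with rfl | hpos
  · rw [elasticaAngle_zero, sub_zero]
    simpa only [elasticaAngle_pi] using
      strictMonoOn_elasticaAngle hmem₂ (right_mem_Icc.mpr pi_pos.le) (by linarith)
  · have := strictMonoOn_elasticaAngle (left_mem_Icc.mpr pi_pos.le) hmem₁ hpos
    rw [elasticaAngle_zero] at this
    linarith [(elasticaAngle_mem_Icc t₂).2]

theorem elasticaXi_eq_sqrtSinPrimitive (ht : t ∈ Icc 0 π) :
    elasticaXi t = sqrtSinPrimitive (elasticaAngle t) / 2 := by
  have hcont : Continuous fun r => sqrtSinPrimitive (elasticaAngle r) / 2 :=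
    ((continuous_iff_continuousAt.mpr fun φ => (hasDerivAt_sqrtSinPrimitive φ).continuousAt).comp
      continuous_elasticaAngle).div_const 2
  refine (intervalIntegral.integral_eq_sub_of_hasDerivAt_of_le ht.1 hcont.continuousOn
    (fun r hr => ?_) (continuous_elasticaXi_integrand.intervalIntegrable 0 t)).trans ?_
  · have hrπ : r ∈ Ioo 0 π := ⟨hr.1, hr.2.trans_le ht.2⟩
    refine (((hasDerivAt_sqrtSinPrimitive _).comp r (hasDerivAt_elasticaAngle hrπ)).div_const
      2).congr_deriv ?_
    rw [sqrt_sin_elasticaAngle (Ioo_subset_Icc_self hrπ)]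
    ring
  · simp [elasticaAngle_zero, sqrtSinPrimitive]

theorem elastica_eq_elasticaOfAngle (ht : t ∈ Icc 0 π) :
    elastica t = elasticaOfAngle (elasticaAngle t) := by
  rw [elastica, elasticaOfAngle, elasticaXi_eq_sqrtSinPrimitive ht, sqrt_sin_elasticaAngle ht,
    Complex.ofReal_div, Complex.ofReal_ofNat]

theorem deriv_elastica_eq (t : ℝ) : deriv elastica t =
    ((√(1 + sin t ^ 2))⁻¹ : ℝ) * Complex.exp (elasticaAngle t * Complex.I) := by
  have hne : (√(1 + sin t ^ 2) : ℂ) ≠ 0 := by exact_mod_cast (sqrt_one_add_sin_sq_pos t).ne'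
  rw [(hasDerivAt_elastica t).deriv, Complex.exp_mul_I, ← Complex.ofReal_cos,
    ← Complex.ofReal_sin, cos_elasticaAngle, sin_elasticaAngle]
  push_cast
  field_simp

theorem norm_deriv_elastica (t : ℝ) : ‖deriv elastica t‖ = (√(1 + sin t ^ 2))⁻¹ := by
  rw [deriv_elastica_eq, norm_mul, Complex.norm_exp_ofReal_mul_I, mul_one, Complex.norm_real,
    norm_of_nonneg (by positivity)]

theorem deriv_elastica_div_norm (t : ℝ) :
    deriv elastica t / ‖deriv elastica t‖ = Complex.exp (elasticaAngle t * Complex.I) := by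
  have hne : (((√(1 + sin t ^ 2))⁻¹ : ℝ) : ℂ) ≠ 0 := by
    exact_mod_cast (inv_pos.mpr (sqrt_one_add_sin_sq_pos t)).ne'
  rw [norm_deriv_elastica, deriv_elastica_eq, mul_div_cancel_left₀ _ hne]

theorem elasticaTangent_eq_elasticaTangentOfAngle (ht : t ∈ Icc 0 π) :
    elasticaTangent t = elasticaTangentOfAngle (elasticaAngle t) := by
  simp only [elasticaTangent, elasticaTangentOfAngle, elastica_eq_elasticaOfAngle ht,
    deriv_elastica_div_norm]

/-! ### Arcs of the rectangular elastica -/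

section ElasticaSegment

variable (h₁₂ : t₁ < t₂)

theorem elasticaSegment_vel (ht : t ∈ Icc t₁ t₂) :
    (elasticaSegment t₁ t₂ h₁₂).vel t = deriv elastica t :=
  derivWithin_elastica h₁₂ ht

theorem elasticaSegment_connects :
    (elasticaSegment t₁ t₂ h₁₂).Connects (elasticaTangent t₁) (elasticaTangent t₂) := by
  have hvel₁ := elasticaSegment_vel h₁₂ (left_mem_Icc.mpr h₁₂.le)
  have hvel₂ := elasticaSegment_vel h₁₂ (right_mem_Icc.mpr h₁₂.le)
  constructor
  · simp only [PlaneCurve.initial, PlaneCurve.tangent, elasticaTangent, ← hvel₁]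
    rfl
  · simp only [PlaneCurve.terminal, PlaneCurve.tangent, elasticaTangent, ← hvel₂]
    rfl

theorem isDirectionAngle_elasticaSegment :
    (elasticaSegment t₁ t₂ h₁₂).IsDirectionAngle
      fun s => elasticaAngle ((elasticaSegment t₁ t₂ h₁₂).arcParam s) :=
  .of_continuousOn
    (continuous_elasticaAngle.comp_continuousOn (PlaneCurve.continuousOn_arcParam _))
    fun s hs => by
      rw [PlaneCurve.unitSpeed_vel _ hs, elasticaSegment_vel h₁₂ (PlaneCurve.arcParam_mem _ hs),
        deriv_elastica_div_norm]

theorem isLeftCCurve_elasticaSegment (h₀ : 0 ≤ t₁) (h₂ : t₂ ≤ π) :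
    (elasticaSegment t₁ t₂ h₁₂).IsLeftCCurve := by
  refine (isDirectionAngle_elasticaSegment h₁₂).isLeftCCurve_iff.mpr ⟨?_, ?_⟩
  · exact strictMonoOn_elasticaAngle.monotoneOn.comp (PlaneCurve.monotoneOn_arcParam _)
      fun s hs => Icc_subset_Icc h₀ h₂ (PlaneCurve.arcParam_mem _ hs)
  · linarith [(elasticaAngle_mem_Icc ((elasticaSegment t₁ t₂ h₁₂).arcParam 0)).1,
      (elasticaAngle_mem_Icc ((elasticaSegment t₁ t₂ h₁₂).arcParam
        (elasticaSegment t₁ t₂ h₁₂).length)).2]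

theorem elasticaSegment_mem_sCurves (h₀ : 0 ≤ t₁) (h₂ : t₂ ≤ π) :
    elasticaSegment t₁ t₂ h₁₂ ∈ sCurves (elasticaTangent t₁) (elasticaTangent t₂) :=
  ⟨.inl (.inl (isLeftCCurve_elasticaSegment h₁₂ h₀ h₂)), elasticaSegment_connects h₁₂⟩

theorem deriv_elasticaAngle_arcParam (h₀ : 0 ≤ t₁) (h₂ : t₂ ≤ π) {s : ℝ}
    (hs : s ∈ Ioo 0 (elasticaSegment t₁ t₂ h₁₂).length) :
    deriv (fun s => elasticaAngle ((elasticaSegment t₁ t₂ h₁₂).arcParam s)) s =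
      2 * √(sin (elasticaAngle ((elasticaSegment t₁ t₂ h₁₂).arcParam s))) := by
  have hp := PlaneCurve.arcParam_mem_Ioo _ hs
  have hpπ := Ioo_subset_Ioo h₀ h₂ hp
  have hderiv := (hasDerivAt_elasticaAngle hpπ).comp s (PlaneCurve.hasDerivAt_arcParam _ hs)
  rw [elasticaSegment_vel h₁₂ (Ioo_subset_Icc_self hp), norm_deriv_elastica, inv_inv,
    div_mul_cancel₀ _ (sqrt_one_add_sin_sq_pos _).ne'] at hderiv
  rw [sqrt_sin_elasticaAngle (Ioo_subset_Icc_self hpπ)]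
  exact hderiv.deriv

theorem bendingEnergy_elasticaSegment (h₀ : 0 ≤ t₁) (h₂ : t₂ ≤ π) :
    (elasticaSegment t₁ t₂ h₁₂).bendingEnergy =
      ENNReal.ofReal (elasticaEnergy (elasticaAngle t₁) (elasticaAngle t₂)) := by
  have hτ := isDirectionAngle_elasticaSegment h₁₂
  have hae : ∀ᵐ s ∂volume.restrict (Icc 0 (elasticaSegment t₁ t₂ h₁₂).length),
      deriv (fun s => elasticaAngle ((elasticaSegment t₁ t₂ h₁₂).arcParam s)) s =
        2 * √(sin (elasticaAngle ((elasticaSegment t₁ t₂ h₁₂).arcParam s))) := by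
    rw [← restrict_Ioo_eq_restrict_Icc]
    filter_upwards [ae_restrict_mem measurableSet_Ioo] with s hs
    exact deriv_elasticaAngle_arcParam h₁₂ h₀ h₂ hs
  have hconnects := elasticaSegment_connects h₁₂
  rw [elasticaTangent_eq_elasticaTangentOfAngle ⟨h₀, h₁₂.le.trans h₂⟩,
    elasticaTangent_eq_elasticaTangentOfAngle ⟨h₀.trans h₁₂.le, h₂⟩] at hconnects
  rw [hτ.bendingEnergy_eq, angleEnergy_eq_of_ae_deriv_eq (PlaneCurve.length_pos _).le
    continuous_sqrt_sin hτ.1 hae, ← (hτ.integral_cos_sin_of_connects hconnects).2]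
  simp only [sq_sqrt (sin_nonneg_of_mem_Icc (elasticaAngle_mem_Icc _))]

end ElasticaSegment

end

theorem theorem6p1 (t₁ t₂ : ℝ) (h₀ : 0 ≤ t₁) (h₁₂ : t₁ < t₂) (h₂ : t₂ ≤ Real.pi)
    (hlt : t₂ - t₁ < Real.pi) :
    (elasticaSegment t₁ t₂ h₁₂ ∈ sCurves (elasticaTangent t₁) (elasticaTangent t₂) ∧
      ∀ g ∈ sCurves (elasticaTangent t₁) (elasticaTangent t₂),
        (elasticaSegment t₁ t₂ h₁₂).bendingEnergy ≤ g.bendingEnergy) ∧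
    ∀ f ∈ sCurves (elasticaTangent t₁) (elasticaTangent t₂),
      (∀ g ∈ sCurves (elasticaTangent t₁) (elasticaTangent t₂),
        f.bendingEnergy ≤ g.bendingEnergy) →
      f.Equivalent (elasticaSegment t₁ t₂ h₁₂) := by
  have hmem₁ : t₁ ∈ Icc 0 Real.pi := ⟨h₀, h₁₂.le.trans h₂⟩
  have hmem₂ : t₂ ∈ Icc 0 Real.pi := ⟨h₀.trans h₁₂.le, h₂⟩
  have hθ := strictMonoOn_elasticaAngle hmem₁ hmem₂ h₁₂
  have hθ_lt := elasticaAngle_sub_lt_pi h₀ h₁₂ h₂ hlt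
  have hseg := elasticaSegment_mem_sCurves h₁₂ h₀ h₂
  have hE := bendingEnergy_elasticaSegment h₁₂ h₀ h₂
  rw [elasticaTangent_eq_elasticaTangentOfAngle hmem₁,
    elasticaTangent_eq_elasticaTangentOfAngle hmem₂] at hseg ⊢
  refine ⟨⟨hseg, fun g hg => hE ▸ PlaneCurve.ofReal_elasticaEnergy_le_bendingEnergy
    (elasticaAngle_mem_Icc t₁).1 hθ (elasticaAngle_mem_Icc t₂).2 hθ_lt hg⟩, fun f hf hmin => ?_⟩
  exact PlaneCurve.equivalent_of_bendingEnergy_le (elasticaAngle_mem_Icc t₁).1 hθ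
    (elasticaAngle_mem_Icc t₂).2 hθ_lt hf hseg (hE ▸ hmin _ hseg) hE.le
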